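/- Let $w$ be a word of length $n$ over an arbitrary alphabet, with positions $1,\dots,n$. For a position $i$, let $\mathsf{LSF}_\ell[i]$ be the largest $k$ such that $w[i..i+k-1]=w[j..j+k-1]$ for some $j$ with $i<j\le n$ and $j+k-1\le n$ ($0$ if $i=n$). If $\mathsf{LSF}_\ell[i]\neq 0$, let $\mathsf{LSF}_r[i]$ be the largest position at which $w[i..i+\mathsf{LSF}_\ell[i]-1]$ occurs; otherwise $\mathsf{LSF}_r[i]=\mathrm{nil}$. The Longest Unbordered Factor Array algorithm starts with $\mathsf{HOOK}[i]=i$ for all $i$ and processes $i=n,n-1,\dots,1$ as follows. 1. If $\mathsf{LSF}_\ell[i]=0$, it sets $\mathsf{LUF}[i]=n-i+1$. Otherwise, with $j=\mathsf{LSF}_r[i]$, it sets $\mathsf{LUF}[i]$ to $j+\mathsf{LUF}[j]-i$ if $\mathsf{LSF}_\ell[i]<\mathsf{LUF}[j]$, to $\mathsf{LUF}[j]$ if $\mathsf{LSF}_\ell[i]\ge\mathsf{LUF}[j]$ and $i\ge\mathsf{HOOK}[j]$, and to $\mathsf{HOOK}[j]-i$ in the remaining case. 2. If $i$ is a potential reference,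 i.e. there is a position $i'$ with $\mathsf{LSF}_r[i']=i$ and $\mathsf{LSF}_\ell[i']\ge\mathsf{LUF}[i]$, it sets $\mathsf{HOOK}[i]\leftarrow\textsc{FindHook}(i)$. $\textsc{FindHook}(j)$ starts with an empty stack, $q=\mathsf{HOOK}[j]$ and $\beta=\textsc{FindBeta}(q,j)$. While $\beta\neq0$, it pops from the top of the stack all pairs $(\text{length},\text{pos})$ with $\text{length}<\beta$ (stopping at the first pair with $\text{length}\ge\beta$), setting $\mathsf{HOOK}[\text{pos}]\leftarrow q$ for each, then pushes $(\beta,q-\beta)$, sets $q\leftarrow\mathsf{HOOK}[q-\beta]$ and $\beta\leftarrow\textsc{FindBeta}(q,j)$. When $\beta=0$, it pops all remaining pairs, setting $\mathsf{HOOK}[\text{pos}]\leftarrow q$ for each, and returns $q$. $\textsc{FindBeta}(q,j)$ searches for the length of the shortest non-empty prefix of $x=w[j..n]$ that is a suffix of $y=w[1..q-1]$, and returns $0$ if it finds none. It asks prefix-suffix queries for $d=d_0,\,2d_0+1,\,2(2d_0+1)+1,\dots$; the query for $d$ reports all $k\in[d,2d]$ such that the prefix of $x$ of length $k$ is a suffix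 of $y$. It stops at the first query with a non-empty answer, returning the smallest reported length, or as soon as $d>\min(|x|,|y|)$, returning $0$. Here $d_0=2\ell+1$, where $\ell$ is the length with which position $j$ was most recently pushed onto a stack ($\ell=0$ if it was never pushed). The running time is measured after preprocessing, with each prefix-suffix query (including the extraction of the smallest reported length) and each comparison of $d$ with $\min(|x|,|y|)$ taking constant time. Then the algorithm terminates on every word, and, with constants depending neither on $w$ nor on the alphabet: - the total size of all the stacks used by the $\textsc{FindHook}$ calls throughout the algorithm, i.e. the total number of pairs pushed onto them, is $\mathcal{O}(n\log n)$; - the total running time of all $\textsc{FindBeta}$ calls is $\mathcal{O}(n\log n)$. -/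

import Mathlib

/-!  Longest Unbordered Factor Array: the algorithm, its stacks, and the cost of its border searches.

Words are lists over an arbitrary alphabet. Positions are numbered from `1` to `n = w.length`, so
`w[i..n]` is `w.drop (i - 1)` and `w[1..i-1]` is `w.take (i - 1)`. Arrays indexed by positions are
functions `ℕ → ℕ`. -/

namespace LUFArray

variable {α : Type*}

/-- The factor `w[i..i+k-1]` of length `k` starting at position `i`
(used only when `1 ≤ i` and `i + k - 1 ≤ n`). -/
def factor (w : List α) (i k : ℕ) : List α :=
  (w.drop (i - 1)).take k

/-- The factors of length `k` at positions `i < j` both lie inside `w` and are equal. -/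
def RepeatsAt (w : List α) (i j k : ℕ) : Prop :=
  i < j ∧ j ≤ w.length ∧ j + k ≤ w.length + 1 ∧ factor w i k = factor w j k

instance [DecidableEq α] (w : List α) (i j k : ℕ) : Decidable (RepeatsAt w i j k) :=
  inferInstanceAs (Decidable (_ ∧ _ ∧ _ ∧ _))

/-- The factor of length `k` at position `i` also starts at some later position. -/
def OccursLater (w : List α) (i k : ℕ) : Prop :=
  ∃ j ∈ Finset.Icc 1 w.length, RepeatsAt w i j k

variable [DecidableEq α]

instance (w : List α) (i k : ℕ) : Decidable (OccursLater w i k) :=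
  inferInstanceAs (Decidable (∃ j ∈ Finset.Icc 1 w.length, RepeatsAt w i j k))

/-- Longest successor factor (length) array: the length of the longest factor that starts at `i`
and also at some later position; it is `0` if `i = n`. -/
def lsfLength (w : List α) (i : ℕ) : ℕ :=
  Nat.findGreatest (fun k : ℕ => OccursLater w i k) w.length

/-- Longest successor factor (reference) array: the last position at which the longest successor
factor of `i` occurs. The value `0`, which is not a position, stands for `nil`. -/
def lsfRef (w : List α) (i : ℕ) : ℕ :=
  if lsfLength w i = 0 then 0
  else Nat.findGreatest (fun j : ℕ => RepeatsAt w i j (lsfLength w i)) w.length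

/-- Position `i` is a potential reference (with respect to the current array `luf`): some position
`i'` refers to `i`, with a longest successor factor of length at least `luf i`. -/
def IsPotentialReference (w : List α) (luf : ℕ → ℕ) (i : ℕ) : Prop :=
  ∃ i' ∈ Finset.Icc 1 w.length, lsfRef w i' = i ∧ luf i ≤ lsfLength w i'

instance (w : List α) (luf : ℕ → ℕ) (i : ℕ) : Decidable (IsPotentialReference w luf i) :=
  inferInstanceAs
    (Decidable (∃ i' ∈ Finset.Icc 1 w.length, lsfRef w i' = i ∧ luf i ≤ lsfLength w i'))

/-- The answer to a prefix-suffix query: all lengths `k` with `d ≤ k ≤ 2 * d` such that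
the prefix of `x` of length `k` exists and is a suffix of `y`. -/
def prefixSuffixQuery (d : ℕ) (x y : List α) : Finset ℕ :=
  (Finset.Icc d (2 * d)).filter (fun k => k ≤ x.length ∧ x.take k <:+ y)

/-- The search loop of `findBeta`: prefix-suffix queries for `d, 2 * d + 1, 2 * (2 * d + 1) + 1, …`
until a query has a non-empty answer or `d` exceeds `min |x| |y|`. Returns the smallest reported
length (`0` if there is none) and the number of steps. A round of the loop, that is, one comparison
and one prefix-suffix query together with the extraction of the smallest reported length, is one
step; so is the final comparison in a search that fails. -/
def findBetaLoop (x y : List α) (d : ℕ) : ℕ × ℕ :=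
  if d ≤ min x.length y.length then
    if h : (prefixSuffixQuery d x y).Nonempty then
      ((prefixSuffixQuery d x y).min' h, 1)
    else
      let r := findBetaLoop x y (2 * d + 1)
      (r.1, r.2 + 1)
  else (0, 1)
termination_by min x.length y.length + 1 - d
decreasing_by omega

/-- `FindBeta(q, j)`: search for the length of the shortest non-empty prefix of `w[j..n]` that is a
suffix of `w[1..q-1]`, together with the number of steps taken. The search starts with
`d = 2 * l + 1`, where `l` is the length with which `j` was last pushed onto a stack
(`l = 0` if `j` has not been pushed onto any stack). -/
def findBeta (w : List α) (l q j : ℕ) : ℕ × ℕ :=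
  findBetaLoop (w.drop (j - 1)) (w.take (q - 1)) (2 * l + 1)

/-- The memory of the algorithm, with two counters for its analysis. -/
structure State where
  /-- the array `LUF` -/
  luf : ℕ → ℕ
  /-- the array `HOOK` -/
  hook : ℕ → ℕ
  /-- `len i` is the length with which position `i` was last pushed onto a stack, `0` if never -/
  len : ℕ → ℕ
  /-- `pushed j` lists the pairs (length, position) pushed onto the stack of `j`, in order -/
  pushed : ℕ → List (ℕ × ℕ)
  /-- the number of steps taken so far by all calls of `findBeta` -/
  betaTime : ℕ

/-- `HandlePopping(st, q, β)`: pop the pairs of length less than `β` off the top of the stack, and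
set `HOOK` to `q` at their positions. The top of the stack is the head of the list. -/
def handlePopping (q : ℕ) (β : ℕ∞) : List (ℕ × ℕ) → (ℕ → ℕ) → List (ℕ × ℕ) × (ℕ → ℕ)
  | [], hook => ([], hook)
  | (l, p) :: st, hook =>
    if (l : ℕ∞) < β then handlePopping q β st (Function.update hook p q)
    else ((l, p) :: st, hook)

/-- The loop of `FindHook(j)` with current stack `st` and current position `q`. The first argument
bounds the number of rounds; the value is `none` if the loop has not ended within this bound. -/
def findHookLoop (w : List α) (j : ℕ) :
    ℕ → List (ℕ × ℕ) → ℕ → State → Option (ℕ × State)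
  | 0, _, _, _ => none
  | fuel + 1, st, q, s =>
    let b := findBeta w (s.len j) q j
    let β := b.1
    let time := s.betaTime + b.2
    if β = 0 then
      some (q, { s with hook := (handlePopping q ⊤ st s.hook).2, betaTime := time })
    else
      let r := handlePopping q (β : ℕ∞) st s.hook
      let p := q - β
      findHookLoop w j fuel ((β, p) :: r.1) (r.2 p)
        { s with
          hook := r.2
          len := Function.update s.len p β
          pushed := Function.update s.pushed j (s.pushed j ++ [(β, p)])
          betaTime := time }

/-- `FindHook(j)`. -/
def findHook (w : List α) (j : ℕ) (s : State) : Option (ℕ × State) :=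
  findHookLoop w j (w.length + 1) [] (s.hook j) s

/-- The value that the main loop assigns to `LUF[i]`. -/
def lufValue (w : List α) (s : State) (i : ℕ) : ℕ :=
  if lsfLength w i = 0 then w.length - i + 1
  else
    let j := lsfRef w i
    if lsfLength w i < s.luf j then j + s.luf j - i
    else if s.hook j ≤ i then s.luf j
    else s.hook j - i

/-- One round of the main loop: compute `LUF[i]` and, if `i` is a potential reference, `HOOK[i]`. -/
def processPosition (w : List α) (i : ℕ) (s : State) : Option State :=
  let s₁ : State := { s with luf := Function.update s.luf i (lufValue w s i) }
  if IsPotentialReference w s₁.luf i then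
    (findHook w i s₁).map fun r => { r.2 with hook := Function.update r.2.hook i r.1 }
  else some s₁

/-- The main loop, for the positions `i, i - 1, …, 1`. -/
def mainLoop (w : List α) : ℕ → State → Option State
  | 0, s => some s
  | i + 1, s => (processPosition w (i + 1) s).bind (mainLoop w i)

/-- The memory before the main loop: `HOOK[i] = i` for all `i`, and no stack has been used. -/
def initialState : State where
  luf := fun _ => 0
  hook := fun i => i
  len := fun _ => 0
  pushed := fun _ => []
  betaTime := 0

/-- The algorithm on input `w`: its final memory, or `none` if some call of `FindHook` does not end
within `n + 1` rounds. -/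
def run (w : List α) : Option State :=
  mainLoop w w.length initialState

/-- The total size of the stacks: the number of pairs pushed onto the stack of `j`, summed over all
positions `j` (nothing is pushed onto the stack of `j` if `FindHook(j)` is not called). -/
def totalStackSize (w : List α) (s : State) : ℕ :=
  ∑ j ∈ Finset.Icc 1 w.length, (s.pushed j).length

end LUFArray

/-! Call the factor at `p` a tile with respect to `k` if it is an unbordered prefix of the suffix at
`k` and the rest of the segment up to `k` is a concatenation of such prefixes. A shortest prefix of
the suffix at `j` that ends just before `q` is unbordered, so `FindHook(j)` builds such a tiling
from right to left, and the hook is the left end of the longest one.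

The invariant `Inv` describes the memory by the word alone: `len p` is the greatest length of a tile
at `p` with respect to a processed potential reference (`0` if there is none), and the hook of an
unprocessed `p` belongs to tiles of length at most `len p`. Hence a search for `j` need not look at
lengths up to `2 * len j` (`Inv.not_agree_of_le`), and the positions jumped over by following hooks
keep their values (`Inv.le_len_of_skipped`).

The key to the count is `Inv.len_eq`: when `FindHook(j)` pushes `p`, the old `len p` equals `len j`.
The new length exceeds `2 * len j`, so `len p + 1` at least doubles. Thus the sum of `log₂ (len p +
1)` over all `p` grows by at least one per push, and by at least the number of rounds of the
successful search, since `d + 1` doubles from round to round. This sum never exceeds `n log₂ n`.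
Each `FindHook` call has just one failing search, of `O(log n)` rounds.

`Inv.len_eq` rests on two facts about words. Two tilings that start at the same position, one ending
at `j` and one at a later position, yield a tile at `j` (`exists_tiles_of_common_cut`); and a tile
at a potential reference with respect to any later position is matched by one, at least as long,
with respect to a potential reference (`exists_isReference_piece`). -/

namespace LUFArray

/-! ### Tilings by unbordered prefixes. -/

section Combinatorics

variable {β : Type*} {f : ℕ → β}

/-- The factors of length `l` at positions `p` and `q` are equal. -/
def Agree (f : ℕ → β) (p q l : ℕ) : Prop := ∀ t < l, f (p + t) = f (q + t)

/-- The factor of length `l` at position `p` has no proper non-empty border. -/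
def Unbordered (f : ℕ → β) (p l : ℕ) : Prop := ∀ k, 0 < k → k < l → ¬ Agree f p (p + l - k) k

theorem Agree.refl (p l : ℕ) : Agree f p p l := fun _ _ => rfl

theorem Agree.symm {p q l : ℕ} (h : Agree f p q l) : Agree f q p l := fun t ht => (h t ht).symm

theorem Agree.trans {p q r l : ℕ} (h : Agree f p q l) (h' : Agree f q r l) : Agree f p r l :=
  fun t ht => (h t ht).trans (h' t ht)

theorem Agree.mono {p q l m : ℕ} (h : Agree f p q l) (hm : m ≤ l) : Agree f p q m :=
  fun t ht => h t (by omega)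

/-- Corresponding subfactors of equal factors are equal. -/
theorem Agree.sub {p q l x y m : ℕ} (h : Agree f p q l) (hx : p ≤ x) (hm : x + m ≤ p + l)
    (hy : y + p = q + x) : Agree f x y m := by
  intro t ht
  have := h (x - p + t) (by omega)
  rwa [show p + (x - p + t) = x + t by omega, show q + (x - p + t) = y + t by omega] at this

/-- Adjacent agreements combine. -/
theorem Agree.append {p q l m : ℕ} (h : Agree f p q l) (h' : Agree f (p + l) (q + l) m) :
    Agree f p q (l + m) := by
  intro t ht
  rcases lt_or_ge t l with h1 | h1
  · exact h t h1
  · have := h' (t - l) (by omega)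
    rwa [show p + l + (t - l) = p + t by omega, show q + l + (t - l) = q + t by omega] at this

theorem Unbordered.congr {p q l : ℕ} (h : Unbordered f p l) (hpq : Agree f p q l) :
    Unbordered f q l := by
  intro k hk hkl hb
  exact h k hk hkl (((hpq.mono hkl.le).trans hb).trans
    (hpq.sub (x := p + l - k) (y := q + l - k) (by omega) (by omega) (by omega)).symm)

theorem Unbordered.not_agree {p l k x : ℕ} (h : Unbordered f p l) (hk : 0 < k) (hkl : k < l)
    (hx : x + k = p + l) : ¬ Agree f p x k := by
  have := h k hk hkl
  rwa [show p + l - k = x by omega] at this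

/-- The segment `[q, p)` is a concatenation of unbordered prefixes, of length at most `m`, of the
word that starts at position `j`. -/
inductive Tiles (f : ℕ → β) (j m : ℕ) : ℕ → ℕ → Prop
  | nil (p : ℕ) : Tiles f j m p p
  | cons {q p : ℕ} (k : ℕ) (hk : 0 < k) (hkm : k ≤ m) (hu : Unbordered f j k)
      (ha : Agree f q j k) (ht : Tiles f j m (q + k) p) : Tiles f j m q p

variable {j m q p : ℕ}

theorem Tiles.le (h : Tiles f j m q p) : q ≤ p := by
  induction h with
  | nil => exact le_rfl
  | cons k hk _ _ _ _ ih => omega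

theorem Tiles.trans {r : ℕ} (h : Tiles f j m q p) (h' : Tiles f j m p r) : Tiles f j m q r := by
  induction h with
  | nil => exact h'
  | cons k hk hkm hu ha _ ih => exact .cons k hk hkm hu ha (ih h')

theorem Tiles.mono {m' : ℕ} (h : Tiles f j m q p) (hm : m ≤ m') : Tiles f j m' q p := by
  induction h with
  | nil => exact .nil _
  | cons k hk hkm hu ha _ ih => exact .cons k hk (hkm.trans hm) hu ha ih

/-- If all longer prefixes are bordered, then every prefix is a concatenation of short unbordered
prefixes. -/
theorem tiles_of_agree_of_bordered {M k : ℕ} (hM : ∀ l, m < l → l ≤ M → ¬ Unbordered f j l) :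
    ∀ q, k ≤ M → Agree f q j k → Tiles f j m q (q + k) := by
  induction k using Nat.strong_induction_on with
  | _ k ih =>
    intro q hk ha
    rcases Nat.eq_zero_or_pos k with rfl | hk0
    · exact .nil _
    by_cases hu : Unbordered f j k
    · have hkm : k ≤ m := by
        by_contra hlt
        exact hM k (by omega) hk hu
      exact .cons k hk0 hkm hu ha (.nil _)
    -- A border of length `b` splits the prefix into the prefixes of lengths `k - b` and `b`.
    · unfold Unbordered at hu
      push Not at hu
      obtain ⟨b, hb, hbk, hab⟩ := hu
      have h1 := ih (k - b) (by omega) q (by omega) (ha.mono (by omega))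
      have h2 := ih b hbk (q + (k - b)) (by omega)
        ((ha.sub (x := q + (k - b)) (y := j + k - b) (by omega) (by omega) (by omega)).trans hab.symm)
      rw [show q + (k - b) + b = q + k by omega] at h2
      exact h1.trans h2

theorem tiles_of_agree {k : ℕ} (hk : k ≤ m) (ha : Agree f q j k) : Tiles f j m q (q + k) :=
  tiles_of_agree_of_bordered (M := m) (fun l h1 h2 => by omega) q hk ha

/-- The tile that contains a given position. -/
theorem Tiles.locate (h : Tiles f j m q p) {g : ℕ} (hq : q ≤ g) (hg : g < p) :
    ∃ e k, q ≤ e ∧ e ≤ g ∧ g < e + k ∧ k ≤ m ∧ Unbordered f j k ∧ Agree f e j k ∧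
      Tiles f j m q e ∧ Tiles f j m (e + k) p := by
  induction h with
  | nil => omega
  | @cons q p k hk hkm hu ha ht ih =>
    rcases lt_or_ge g (q + k) with h1 | h1
    · exact ⟨q, k, le_rfl, hq, h1, hkm, hu, ha, .nil _, ht⟩
    · obtain ⟨e, k', h2, h3, h4, h5, h6, h7, h8, h9⟩ := ih h1 hg
      exact ⟨e, k', by omega, h3, h4, h5, h6, h7, .cons k hk hkm hu ha h8, h9⟩

/-- Every non-empty prefix of a tiled segment ends with a prefix of the base word. -/
theorem Tiles.exists_suffix (h : Tiles f j m q p) {e : ℕ} (hq : q < e) (he : e ≤ p) :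
    ∃ c, q ≤ c ∧ c < e ∧ e ≤ c + m ∧ Agree f c j (e - c) ∧ Tiles f j m q c := by
  obtain ⟨c, k, h1, h2, h3, h4, h5, h6, h7, -⟩ := h.locate (g := e - 1) (by omega) (by omega)
  exact ⟨c, h1, by omega, by omega, h6.mono (by omega), h7⟩

theorem Tiles.take (h : Tiles f j m q p) {e : ℕ} (hq : q ≤ e) (he : e ≤ p) :
    Tiles f j m q e := by
  rcases hq.eq_or_lt with rfl | hlt
  · exact .nil _
  obtain ⟨c, h1, h2, h3, h4, h5⟩ := h.exists_suffix hlt he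
  have := tiles_of_agree (m := m) (by omega) h4
  rw [show c + (e - c) = e by omega] at this
  exact h5.trans this

theorem Tiles.shift (h : Tiles f j m q p) {q' p' : ℕ} (ha : Agree f q q' (p - q))
    (hp : p' + q = q' + p) : Tiles f j m q' p' := by
  induction h generalizing q' with
  | nil => obtain rfl : p' = q' := by omega
           exact .nil _
  | @cons q p k hk hkm hu hkj ht ih =>
    have hle := ht.le
    refine .cons k hk hkm hu ((ha.mono (by omega)).symm.trans hkj) (ih ?_ (by omega))
    exact ha.sub (by omega) (by omega) (by omega)

/-- Change of the base word. -/
theorem Tiles.rebase {k m' : ℕ} (hb : ∀ s ≤ m, Tiles f k m' j (j + s)) (h : Tiles f j m q p) :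
    Tiles f k m' q p := by
  induction h with
  | nil => exact .nil _
  | @cons q p l hl hlm hu ha ht ih =>
    refine Tiles.trans ((hb l hlm).shift (q' := q) (p' := q + l) ?_ (by omega)) ih
    rw [show j + l - j = l by omega]
    exact ha.symm

theorem Tiles.congr {j' : ℕ} (ha : Agree f j j' m) (h : Tiles f j m q p) : Tiles f j' m q p :=
  h.rebase fun _ hs => tiles_of_agree hs (ha.mono hs)

/-- The tiling of `[j, k)`, followed by the suffix at `k` itself, tiles the whole suffix at `j`; so
every prefix of that suffix splits into prefixes of the suffix at `k`. -/
theorem Tiles.rebase_suffix {k N : ℕ} (hkN : k ≤ N) (hb : Tiles f k (N - k) j k)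
    (h : Tiles f j (N - j) q p) : Tiles f k (N - k) q p := by
  have h1 : Tiles f k (N - k) j (k + (N - k)) := hb.trans (tiles_of_agree le_rfl (Agree.refl _ _))
  rw [show k + (N - k) = N by omega] at h1
  have := hb.le
  exact h.rebase fun s hs => h1.take (by omega) (by omega)

/-- A tiling of `[q, j)` extends over the word that starts at `j`. -/
theorem Tiles.extend (h : Tiles f j m q j) {e : ℕ} (he : e ≤ j + m) (hq : q ≤ e) :
    Tiles f j m q e :=
  (h.trans (tiles_of_agree le_rfl (Agree.refl _ _))).take hq he

/-- The first tile is at least as long as any unbordered prefix of the base word that occurs at the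
same position. -/
theorem Tiles.first_ge (h : Tiles f j m q j) (hq : q < j) {b : ℕ} (hbm : b ≤ m)
    (hu : Unbordered f j b) (ha : Agree f q j b) :
    ∃ l, b ≤ l ∧ 0 < l ∧ l ≤ m ∧ Unbordered f j l ∧ Agree f q j l ∧ Tiles f j m (q + l) j := by
  cases h with
  | nil => omega
  | cons k hk hkm hku hka ht =>
    refine ⟨k, ?_, hk, hkm, hku, hka, ht⟩
    by_contra hlt
    -- With a shorter first tile, the occurrence of the prefix of length `b` would end in a later,
    -- possibly truncated tile, which is a border of it.
    obtain ⟨c, h1, h2, h3, h4, -⟩ := (ht.extend (e := q + b) (by omega) (by omega)).exists_suffix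
      (e := q + b) (by omega) le_rfl
    refine hu.not_agree (k := q + b - c) (x := j + (c - q)) (by omega) (by omega) (by omega) ?_
    exact h4.symm.trans (ha.sub (by omega) (by omega) (by omega))

/-- The first tile, or the end, where an unbordered prefix of length `b` fits. -/
theorem Tiles.exists_long_cut {b : ℕ} (hb : 0 < b) (h : Tiles f j m q p) (hp : p = j) :
    ∃ g, q ≤ g ∧ g ≤ j ∧ Tiles f j (b - 1) q g ∧ Agree f g j b ∧ Tiles f j m g j := by
  induction h with
  | nil => subst hp; exact ⟨_, le_rfl, le_rfl, .nil _, Agree.refl _ _, .nil _⟩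
  | @cons q p k hk hkm hu ha ht ih =>
    rcases lt_or_ge k b with h1 | h1
    · obtain ⟨g, h2, h3, h4, h5, h6⟩ := ih hp
      exact ⟨g, by omega, h3, .cons k hk (by omega) hu ha h4, h5, h6⟩
    · have := ht.le
      subst hp
      exact ⟨q, le_rfl, by omega, .nil _, ha.mono h1, .cons k hk hkm hu ha ht⟩

/-- An occurrence of an unbordered word is a cut of every tiling by prefixes of this word. -/
theorem Tiles.drop (h : Tiles f j m q p) {x : ℕ} (hq : q ≤ x) (hx : x ≤ p)
    (ha : Agree f x j m) : Tiles f j m x p := by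
  rcases hx.eq_or_lt with rfl | hlt
  · exact .nil _
  obtain ⟨e, k, h1, h2, h3, h4, h5, h6, h7, h8⟩ := h.locate hq hlt
  rcases h2.eq_or_lt with rfl | h2
  · exact .cons k (by omega) h4 h5 h6 h8
  -- If `x` were strictly inside a tile, the part of the tile from `x` on would be a border of it.
  · exact (h5.not_agree (k := e + k - x) (x := j + (x - e)) (by omega) (by omega) (by omega)
      ((ha.symm.mono (by omega)).trans (h6.sub (by omega) (by omega) (by omega)))).elim

/-- Tilings with short and with arbitrary tiles have the cut `g` in common. -/
theorem Tiles.drop_of_short (h : Tiles f j m q j) {b g : ℕ} (hs : Tiles f j (b - 1) q g)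
    (hg : g ≤ j) (ha : Agree f g j b) (hu : Unbordered f j b) (hb : 0 < b) : Tiles f j m g j := by
  rcases hg.eq_or_lt with rfl | hlt
  · exact .nil _
  obtain ⟨e, k, h1, h2, h3, h4, h5, h6, h7, h8⟩ := h.locate hs.le hlt
  rcases h2.eq_or_lt with rfl | h2
  · exact .cons k (by omega) h4 h5 h6 h8
  exfalso
  -- Suppose `g` is strictly inside the tile `[e, e + k)`. If the occurrence of the `b`-prefix at
  -- `g` ends inside the tile, then the `b`-prefix at `e` gets a border, from its overlap with that
  -- occurrence or from a short tile; otherwise the overlap is a border of the tile.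
  rcases lt_or_ge (g + b) (e + k) with h9 | h9
  · rcases lt_or_ge g (e + b) with h10 | h10
    · exact hu.not_agree (k := e + b - g) (x := j + (g - e)) (by omega) (by omega) (by omega)
        ((ha.symm.mono (by omega)).trans (h6.sub (by omega) (by omega) (by omega)))
    · obtain ⟨c, c1, c2, c3, c4, -⟩ := hs.exists_suffix (e := e + b) (by omega) h10
      exact hu.not_agree (k := e + b - c) (x := j + (c - e)) (by omega) (by omega) (by omega)
        (c4.symm.trans (h6.sub (by omega) (by omega) (by omega)))
  · exact h5.not_agree (k := e + k - g) (x := j + (g - e)) (by omega) (by omega) (by omega)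
      ((ha.symm.mono (by omega)).trans (h6.sub (by omega) (by omega) (by omega)))

/-- A longer unbordered word at the start of a tiled segment contains the next occurrence of the
first tile. -/
theorem lt_of_unbordered_of_tiles {r l M g : ℕ} (hM : Unbordered f r M) (hlM : l < M)
    (hr : Agree f r j l) (hs : Tiles f j (l - 1) (r + l) g) (hg : Agree f g j l) :
    g + l < r + M := by
  by_contra hlt
  have h1 : Tiles f j l (r + l) (g + l) := (hs.mono (by omega)).trans (tiles_of_agree le_rfl hg)
  obtain ⟨c, c1, c2, c3, c4, -⟩ := h1.exists_suffix (e := r + M) (by omega) (by omega)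
  exact hM.not_agree (k := r + M - c) (x := c) (by omega) (by omega) (by omega)
    ((hr.mono (by omega)).trans c4.symm)

/-- If a segment that starts at `r` can be tiled up to `j₁` by prefixes of the suffix at `j₁`, and up to
`j > j₁` by prefixes of the suffix at `j`, where the same unbordered word of length `b` starts at `r`,
`j₁` and `j`, then a segment that starts at `j₁` can be tiled in this way. -/
theorem exists_tiles_of_common_cut {N b j₁ : ℕ} (hb : 0 < b) (d : ℕ) : ∀ r j, j₁ - r ≤ d →
    r ≤ j₁ → j₁ < j → j + b ≤ N → Unbordered f r b → Agree f r j₁ b → Agree f r j b →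
    Tiles f j (N - j) r j → Tiles f j₁ (N - j₁) r j₁ →
    ∃ k, j₁ < k ∧ k + b ≤ N ∧ Agree f j₁ k b ∧ Tiles f k (N - k) j₁ k := by
  induction d with
  | zero =>
    intro r j hd hr hj hN hu ha1 ha ht ht1
    obtain rfl : r = j₁ := by omega
    exact ⟨j, hj, hN, ha, ht⟩
  | succ d ih =>
    intro r j hd hr hj hN hu ha1 ha ht ht1
    rcases hr.eq_or_lt with rfl | hr
    · exact ⟨j, hj, hN, ha, ht⟩
    obtain ⟨l, hbl, hl0, hlN, hlu, hla, hlt⟩ := ht.first_ge (by omega) (by omega) (hu.congr ha) ha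
    obtain ⟨m, hbm, hm0, hmN, hmu, hma, hmt⟩ :=
      ht1.first_ge (by omega) (by omega) (hu.congr ha1) ha1
    -- Compare the first tiles at `r`: `l` for the tiling up to `j`, `m` for the one up to `j₁`. If
    -- `l < m`, the next place `g` where the prefix of length `l` fits lies inside the longer tile,
    -- whose copy at `j₁` gives the desired `k`. Otherwise both tilings are cut at `g`, which is
    -- closer to `j₁`, and the induction applies.
    rcases lt_or_ge l m with hlm | hlm
    · obtain ⟨g, g1, g2, g3, g4, g5⟩ := hlt.exists_long_cut hl0 rfl
      have hg := lt_of_unbordered_of_tiles (hmu.congr hma.symm) hlm hla g3 g4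
      have hkj : Agree f (j₁ + (g - r)) j l :=
        (hma.sub (x := g) (y := j₁ + (g - r)) (by omega) (by omega) (by omega)).symm.trans g4
      refine ⟨j₁ + (g - r), by omega, by omega, ?_, ?_⟩
      · exact ha1.symm.trans (ha.trans (hkj.symm.mono hbl))
      · have h1 : Tiles f j l r g := .cons l hl0 le_rfl hlu hla (g3.mono (by omega))
        have h2 : Tiles f j l j₁ (j₁ + (g - r)) :=
          h1.shift (hma.mono (by omega)) (by omega)
        exact (h2.congr hkj.symm).mono (by omega)
    · obtain ⟨g, g1, g2, g3, g4, g5⟩ := hmt.exists_long_cut hm0 rfl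
      rcases hlm.eq_or_lt with rfl | hlm
      · have h1 : Agree f j₁ j m := hma.symm.trans hla
        exact ih g j (by omega) g2 hj hN (hu.congr (ha1.trans (g4.symm.mono hbm)))
          (g4.mono hbm) ((g4.trans h1).mono hbm)
          (hlt.drop_of_short (g3.congr (h1.mono (by omega))) (by omega) (g4.trans h1) hlu hm0) g5
      · have hg := lt_of_unbordered_of_tiles (hlu.congr hla.symm) hlm hma g3 g4
        have hkg : Agree f g (j + (g - r)) (r + l - g) := hla.sub (by omega) (by omega) (by omega)
        -- Here `m < l`, and the right end moves from `j` to the copy `j + (g - r)` of `g`. The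
        -- segment between them copies `[r, g)`, hence is tiled by prefixes of length at most `m`.
        have hW : Tiles f (j + (g - r)) (N - (j + (g - r))) j (j + (g - r)) := by
          have h1 : Tiles f j₁ m r g := .cons m hm0 le_rfl hmu hma (g3.mono (by omega))
          have h2 : Tiles f j₁ m j (j + (g - r)) := h1.shift (hla.mono (by omega)) (by omega)
          exact (h2.congr (g4.symm.trans (hkg.mono (by omega)))).mono (by omega)
        have hgk : Tiles f (j + (g - r)) (N - (j + (g - r))) g (j + (g - r)) := by
          have h1 := tiles_of_agree (m := N - (j + (g - r))) (by omega) hkg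
          rw [show g + (r + l - g) = r + l by omega] at h1
          exact (h1.trans (hW.rebase_suffix (by omega) hlt)).trans hW
        exact ih g (j + (g - r)) (by omega) g2 (by omega) (by omega)
          (hu.congr (ha1.trans (g4.symm.mono hbm))) (g4.mono hbm) (hkg.mono (by omega)) hgk g5

end Combinatorics

/-! ### Longest unbordered factors and potential references. -/

section References

variable {β : Type*} {f : ℕ → β} {N : ℕ}

/-- The longest unbordered factor that starts at `p`, in a word that ends before `N`, has length
`l`. -/
structure IsLuf (f : ℕ → β) (N p l : ℕ) : Prop where
  pos : 0 < l
  le : p + l ≤ N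
  unbordered : Unbordered f p l
  bordered : ∀ m, l < m → p + m ≤ N → ¬ Unbordered f p m

/-- The longest successor factor of `i` has length `L` and occurs last at `j`. -/
structure IsLsf (f : ℕ → β) (N i L j : ℕ) : Prop where
  lt : i < j
  pos : 0 < L
  le : j + L ≤ N
  agree : Agree f i j L
  longest : ∀ j' L', i < j' → L < L' → j' + L' ≤ N → ¬ Agree f i j' L'
  last : ∀ j', j < j' → j' + L ≤ N → ¬ Agree f i j' L

/-- Some position refers to `j` with a longest successor factor that is at least as long as the
longest unbordered factor of `j`. -/
def IsReference (f : ℕ → β) (N j : ℕ) : Prop :=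
  ∃ i L l, 1 ≤ i ∧ IsLsf f N i L j ∧ IsLuf f N j l ∧ l ≤ L

/-- The factor of length `l` at `p` is a tile in a tiling of `[p, k)` by unbordered prefixes of the
suffix at `k`. -/
structure Piece (f : ℕ → β) (N p l k : ℕ) : Prop where
  pos : 0 < l
  le : k + l ≤ N
  unbordered : Unbordered f k l
  agree : Agree f p k l
  tiles : Tiles f k (N - k) (p + l) k

theorem exists_isLuf {p : ℕ} (hp : p < N) : ∃ l, IsLuf f N p l := by
  classical
  have h1 : Unbordered f p 1 := fun k h1 h2 => by omega
  have hs := Nat.findGreatest_spec (P := fun l => Unbordered f p l) (m := 1) (n := N - p)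
    (by omega) h1
  have hle := Nat.findGreatest_le (P := fun l => Unbordered f p l) (N - p)
  have hge := Nat.le_findGreatest (P := fun l => Unbordered f p l) (m := 1) (n := N - p)
    (by omega) h1
  exact ⟨_, by omega, by omega, hs, fun m hm hmN =>
    Nat.findGreatest_is_greatest hm (by omega)⟩

theorem IsLuf.unique {p l l' : ℕ} (h : IsLuf f N p l) (h' : IsLuf f N p l') : l = l' := by
  by_contra hne
  rcases Nat.lt_or_gt_of_ne hne with h1 | h1
  · exact h.bordered _ h1 h'.le h'.unbordered
  · exact h'.bordered _ h1 h.le h.unbordered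

/-- Prefixes longer than the longest unbordered one are bordered, so they split further. -/
theorem IsLuf.tiles {k l p q : ℕ} (h : IsLuf f N k l) (ht : Tiles f k (N - k) q p) :
    Tiles f k l q p :=
  ht.rebase fun s hs => tiles_of_agree_of_bordered (M := N - k)
    (fun m h1 h2 => h.bordered m h1 (by have := h.le; omega)) k hs (Agree.refl _ _)

theorem IsLuf.tiles_self {k l : ℕ} (h : IsLuf f N k l) : Tiles f k l k N := by
  have := h.tiles (tiles_of_agree (k := N - k) le_rfl (Agree.refl _ _))
  rwa [show k + (N - k) = N by have := h.le; omega] at this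

/-- A longer prefix ends in a possibly truncated tile, which is a border of it. -/
theorem isLuf_of_tiles {k l : ℕ} (hl : 0 < l) (hk : k + l ≤ N) (hu : Unbordered f k l)
    (ht : Tiles f k l k N) : IsLuf f N k l := by
  refine ⟨hl, hk, hu, fun m hm hN hum => ?_⟩
  obtain ⟨c, c1, c2, c3, c4, -⟩ := ht.exists_suffix (e := k + m) (by omega) hN
  exact hum.not_agree (by omega) (by omega) (by omega) c4.symm

theorem exists_isLsf {i j b : ℕ} (hij : i < j) (hb : 0 < b) (hj : j + b ≤ N)
    (ha : Agree f i j b) : ∃ L k, b ≤ L ∧ IsLsf f N i L k := by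
  classical
  let P := fun L => ∃ k, i < k ∧ k + L ≤ N ∧ Agree f i k L
  have hP : P b := ⟨j, hij, hj, ha⟩
  have hge := Nat.le_findGreatest (P := P) (n := N) (by omega) hP
  obtain ⟨k, hk⟩ := Nat.findGreatest_spec (P := P) (n := N) (by omega) hP
  have hmax := fun L => Nat.findGreatest_is_greatest (P := P) (n := N) (k := L)
  generalize Nat.findGreatest P N = L at *
  let R := fun k => i < k ∧ k + L ≤ N ∧ Agree f i k L
  obtain ⟨h1, h2, h3⟩ := Nat.findGreatest_spec (P := R) (n := N) (by omega) hk
  have hlast := fun j => Nat.findGreatest_is_greatest (P := R) (n := N) (k := j)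
  generalize Nat.findGreatest R N = k' at *
  exact ⟨L, k', hge, h1, by omega, h2, h3,
    fun j' L' h4 h5 h6 h7 => hmax L' h5 (by omega) ⟨j', h4, h6, h7⟩,
    fun j' h4 h5 h6 => hlast j' h4 (by omega) ⟨by omega, h5, h6⟩⟩

theorem IsLsf.unique {i L L' j j' : ℕ} (h : IsLsf f N i L j) (h' : IsLsf f N i L' j') :
    L = L' ∧ j = j' := by
  obtain rfl : L = L' := by
    by_contra hne
    rcases Nat.lt_or_gt_of_ne hne with h1 | h1
    · exact h.longest _ _ h'.lt h1 h'.le h'.agree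
    · exact h'.longest _ _ h.lt h1 h.le h.agree
  refine ⟨rfl, ?_⟩
  by_contra hne
  rcases Nat.lt_or_gt_of_ne hne with h1 | h1
  · exact h.last _ h1 h'.le h'.agree
  · exact h'.last _ h1 h.le h.agree

/-- The tile at a given position is unique. -/
theorem Piece.unique {p l l' k : ℕ} (h : Piece f N p l k) (h' : Piece f N p l' k) : l = l' := by
  have key : ∀ {l l'}, Piece f N p l k → Piece f N p l' k → ¬ l < l' := by
    intro l l' h h' hlt
    have := h'.tiles.le
    obtain ⟨c, c1, c2, c3, c4, -⟩ := h.tiles.exists_suffix (e := p + l') (by omega) (by omega)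
    exact h'.unbordered.not_agree (k := p + l' - c) (x := k + (c - p)) (by omega)
      (by have := h.pos; omega) (by omega)
      (c4.symm.trans (h'.agree.sub (by omega) (by omega) (by omega)))
  by_contra hne
  rcases Nat.lt_or_gt_of_ne hne with h1 | h1
  · exact key h h' h1
  · exact key h' h h1

theorem Piece.tiles_self {p l k : ℕ} (h : Piece f N p l k) : Tiles f k (N - k) p k :=
  .cons l h.pos (by have := h.le; omega) h.unbordered h.agree h.tiles

theorem Piece.lt {p l k : ℕ} (h : Piece f N p l k) : p + l ≤ k := h.tiles.le

theorem exists_piece_ge {p k b : ℕ} (ht : Tiles f k (N - k) p k) (hp : p < k) (hb : k + b ≤ N)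
    (hu : Unbordered f k b) (ha : Agree f p k b) : ∃ l, b ≤ l ∧ Piece f N p l k := by
  obtain ⟨l, h1, h2, h3, h4, h5, h6⟩ := ht.first_ge hp (by omega) hu ha
  exact ⟨l, h1, h2, by have := ht.le; omega, h4, h5, h6⟩

/-- The position `p` itself refers to `k'`. The word from `p` to its end is tiled by prefixes of the
unbordered word of length `l`, and `k'` is an occurrence of that word, hence a cut; so the longest
unbordered factor at `k'` has length `l` too. -/
theorem isReference_of_luf_eq {p l k : ℕ} (hp : 1 ≤ p) (h : Piece f N p l k)
    (hl : IsLuf f N k l) : ∃ k' l', p < k' ∧ l ≤ l' ∧ IsReference f N k' ∧ Piece f N p l' k' := by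
  have hpos := h.pos
  have hlt := h.lt
  obtain ⟨L, k', hL, hk⟩ := exists_isLsf (by omega) h.pos h.le h.agree
  have h1 := hk.lt
  have h2 := hk.le
  have ht : Tiles f k l p N := (hl.tiles h.tiles_self).trans hl.tiles_self
  have ha : Agree f k k' l := h.agree.symm.trans (hk.agree.mono hL)
  have hluf : IsLuf f N k' l := isLuf_of_tiles h.pos (by omega) (h.unbordered.congr ha)
    ((ht.drop (by omega) (by omega) ha.symm).congr ha)
  obtain ⟨l', h3, h4⟩ := exists_piece_ge (N := N) (((ht.take h1.le (by omega)).congr ha).mono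
    (by omega)) h1 (by omega) hluf.unbordered (hk.agree.mono hL)
  exact ⟨k', l', h1, h3, ⟨p, L, l, hp, hk, hluf, hL⟩, h4⟩

/-- The position `i` that refers to `j`, shifted by `g - j`, yields an occurrence of a long factor
at `g`. The last position before `j` with this factor is shown to refer to `g`. -/
theorem isReference_of_first {j l k g m : ℕ} (hj : IsReference f N j) (hp : Piece f N j l k)
    (hm : IsLuf f N k m) (hlm : l < m) (hjg : j < g) (hgk : g ≤ k) (hg : Agree f g k m)
    (hfirst : ∀ x, j ≤ x → x < g → ¬ Agree f x k m) : IsReference f N g := by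
  obtain ⟨i, L, l₁, hi, hlsf, hluf, hle⟩ := hj
  have hmN := hm.le
  have hpk := hp.lt
  have ht : Tiles f k m (j + l) N := (hm.tiles hp.tiles).trans hm.tiles_self
  have htj : Tiles f k m j N := (hm.tiles hp.tiles_self).trans hm.tiles_self
  have hgN : g + m ≤ N := by omega
  -- A border of length `s` yields a border of the longest unbordered factor of `k` if `s ≤ m`
  -- (directly for `s ≤ l`, by a truncated tile otherwise), and an occurrence of it before `g` if `s
  -- > m`.
  have hunb : Unbordered f j (g - j + m) := by
    intro s hs hsm hb
    rcases le_or_gt s l with h1 | h1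
    · refine hm.unbordered.not_agree (k := s) (x := k + m - s) hs (by omega) (by omega) ?_
      exact ((hp.agree.mono h1).symm.trans hb).trans
        (hg.sub (by omega) (by omega) (by omega))
    · rcases le_or_gt s m with h2 | h2
      · obtain ⟨c, c1, c2, c3, c4, -⟩ := ht.exists_suffix (e := j + s) (by omega) (by omega)
        have := hp.pos
        refine hm.unbordered.not_agree (k := j + s - c) (x := k + m - (j + s - c)) (by omega)
          (by omega) (by omega) ?_
        refine (c4.symm.trans (hb.sub (x := c) (y := g + m - (j + s - c)) (by omega) (by omega)
          (by omega))).trans (hg.sub (by omega) (by omega) (by omega))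
      · refine hfirst (j + s - m) (by omega) (by omega) ?_
        exact (hb.sub (x := j + s - m) (y := g) (by omega) (by omega) (by omega)).trans hg
  have hl₁ : g - j + m ≤ l₁ := by
    by_contra hlt
    exact hluf.bordered _ (by omega) (by omega) hunb
  have hlufg : IsLuf f N g m := isLuf_of_tiles hm.pos hgN (hm.unbordered.congr hg.symm)
    ((htj.drop hjg.le (by omega) hg).congr hg.symm)
  -- Otherwise the occurrences of the unbordered factor at `i` and `j` overlap.
  have hil : i + l₁ ≤ j := by
    by_contra hlt
    have hij := hlsf.lt
    refine hluf.unbordered.not_agree (k := i + l₁ - j) (x := j + l₁ - (i + l₁ - j)) (by omega)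
      (by omega) (by omega) ?_
    exact (hlsf.agree.sub (x := j) (y := j + l₁ - (i + l₁ - j)) (by omega) (by omega) (by omega))
  have hLN := hlsf.le
  have hmpos := hm.pos
  have h0 : i + (g - j) < j ∧ Agree f (i + (g - j)) g (L - (g - j)) :=
    ⟨by omega, hlsf.agree.sub (by omega) (by omega) (by omega)⟩
  obtain ⟨i', hi', hi'a, hi'j, hi'max⟩ : ∃ i', i + (g - j) ≤ i' ∧
      Agree f i' g (L - (g - j)) ∧ i' < j ∧
      ∀ x, i' < x → x < j → ¬ Agree f x g (L - (g - j)) := by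
    classical
    let P := fun x => x < j ∧ Agree f x g (L - (g - j))
    have h1 := Nat.le_findGreatest (P := P) (n := j) (by omega) h0
    have h2 := Nat.findGreatest_spec (P := P) (n := j) (by omega) h0
    exact ⟨_, h1, h2.2, h2.1, fun x h3 h4 h5 =>
      Nat.findGreatest_is_greatest (P := P) h3 h4.le ⟨h4, h5⟩⟩
  obtain ⟨L', k', hL', hlsf'⟩ := exists_isLsf (N := N) (i := i') (j := g) (by omega)
    (by omega) (by omega) hi'a
  have hkg : Agree f k' g (L - (g - j)) := (hlsf'.agree.symm.mono hL').trans hi'a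
  have hi'k := hlsf'.lt
  have hk'N := hlsf'.le
  have hjk : j ≤ k' := by
    by_contra hlt
    exact hi'max k' hi'k (by omega) hkg
  -- Let `[h, h + s)` be the tile, with base `j`, that contains `k'`. The bounds `hend` and `hge`
  -- force `s = l₁` and `k' - h = g - j`; then the successor factor of `i` occurs at `h`, so `h = j`
  -- because `j` is its last occurrence.
  obtain ⟨h, s, s1, s2, s3, s4, s5, s6, -, s8⟩ := hluf.tiles_self.locate hjk (by omega)
  have hend : k' + (l₁ - (g - j)) ≤ h + s := by
    by_contra hlt
    obtain ⟨c, c1, c2, c3, c4, -⟩ := s8.exists_suffix (e := k' + (l₁ - (g - j))) (by omega)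
      (by omega)
    refine hluf.unbordered.not_agree (k := k' + (l₁ - (g - j)) - c)
      (x := j + l₁ - (k' + (l₁ - (g - j)) - c)) (by omega) (by omega) (by omega) ?_
    exact c4.symm.trans (hkg.sub (by omega) (by omega) (by omega))
  have hge : g - j ≤ k' - h := by
    by_contra hlt
    refine hfirst (j + (k' - h)) (by omega) (by omega) ?_
    exact (s6.sub (x := k') (by omega) (by omega) (by omega)).symm.trans
      ((hkg.mono (by omega)).trans hg)
  have hih : Agree f i h L := by
    have h1 : Agree f i h (g - j) := (hlsf.agree.mono (by omega)).trans
      (s6.symm.mono (by omega))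
    have h2 : Agree f (i + (g - j)) (h + (g - j)) (L - (g - j)) := by
      rw [show h + (g - j) = k' by omega]
      exact h0.2.trans hkg.symm
    have := h1.append h2
    rwa [show g - j + (L - (g - j)) = L by omega] at this
  obtain rfl : h = j := by
    by_contra hne
    exact hlsf.last h (by omega) (by omega) hih
  obtain rfl : k' = g := by omega
  exact ⟨i', L', m, by omega, hlsf', hlufg, by omega⟩

/-- A tile of a potential reference with respect to any later position is at most as long as a tile
with respect to some later potential reference. -/
theorem exists_isReference_piece {j : ℕ} (hj : IsReference f N j) {l k : ℕ}
    (hp : Piece f N j l k) :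
    ∃ k' l', l ≤ l' ∧ IsReference f N k' ∧ Piece f N j l' k' := by
  classical
  have hj1 : 1 ≤ j := by
    obtain ⟨i, L, l₁, hi, hlsf, -⟩ := hj
    have := hlsf.lt
    omega
  let P := fun l => ∃ k, Piece f N j l k
  have hP : P l := ⟨k, hp⟩
  have hlN : l ≤ N := by have := hp.le; omega
  have hge := Nat.le_findGreatest (P := P) (n := N) hlN hP
  obtain ⟨k₀, h₀⟩ := Nat.findGreatest_spec (P := P) (n := N) hlN hP
  -- `l₀` is the longest tile at `j` with respect to any later position, reference or not.
  have hmax := fun L => Nat.findGreatest_is_greatest (P := P) (n := N) (k := L)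
  generalize Nat.findGreatest P N = l₀ at *
  clear hp hP hlN
  have hlt := h₀.lt
  have hpos := h₀.pos
  have hk₀ := h₀.le
  obtain ⟨m, hm⟩ := exists_isLuf (f := f) (N := N) (p := k₀) (by omega)
  have hmN := hm.le
  have hlm : l₀ ≤ m := by
    by_contra hlt
    exact hm.bordered _ (by omega) hk₀ h₀.unbordered
  rcases hlm.eq_or_lt with rfl | hlm
  · obtain ⟨k', l', -, h2, h3, h4⟩ := isReference_of_luf_eq hj1 h₀ hm
    exact ⟨k', l', by omega, h3, h4⟩
  -- The new reference is the first occurrence, from `j` on, of the longest unbordered factor of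
  -- `k₀`. It is not `j`, where this factor would give a tile longer than `l₀`.
  have hex : ∃ g, j ≤ g ∧ Agree f g k₀ m := ⟨k₀, by omega, Agree.refl _ _⟩
  obtain ⟨h1, h2⟩ := Nat.find_spec hex
  have hgk := Nat.find_min' hex ⟨by omega, Agree.refl k₀ m⟩
  have hmin := fun x => Nat.find_min hex (m := x)
  generalize Nat.find hex = g at *
  have hjg : j < g := by
    by_contra hle
    obtain rfl : g = j := by omega
    obtain ⟨l', h3, h4⟩ := exists_piece_ge h₀.tiles_self (by omega) hmN hm.unbordered h2
    have := h4.le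
    exact hmax l' (by omega) (by omega) ⟨k₀, h4⟩
  have href := isReference_of_first hj h₀ hm hlm hjg hgk h2
    fun x h3 h4 h5 => hmin x h4 ⟨h3, h5⟩
  have ht : Tiles f g (N - g) j g :=
    (((hm.tiles h₀.tiles_self).take h1 hgk).congr h2.symm).mono (by omega)
  have ha : Agree f j g l₀ := h₀.agree.trans (h2.symm.mono hlm.le)
  obtain ⟨l', h3, h4⟩ := exists_piece_ge ht hjg (by omega) (h₀.unbordered.congr
    (h2.symm.mono hlm.le)) ha
  exact ⟨g, l', by omega, href, h4⟩

/-! The three cases of the computation of a longest unbordered factor. -/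

theorem isLuf_of_forall_not_agree {i : ℕ} (hi : i < N)
    (h : ∀ j L, i < j → 0 < L → j + L ≤ N → ¬ Agree f i j L) : IsLuf f N i (N - i) :=
  ⟨by omega, by omega, fun k h1 h2 => h _ _ (by omega) h1 (by omega), fun m h1 h2 => by omega⟩

/-- A border is no longer than the longest successor factor. -/
theorem IsLsf.le_of_agree {i L j x k : ℕ} (h : IsLsf f N i L j) (hx : i < x) (hk : x + k ≤ N)
    (ha : Agree f i x k) : k ≤ L := by
  by_contra hlt
  exact h.longest x k hx (by omega) hk ha

/-- A border would have length at most `L`, so it would reappear as a border of the factor at `j`. A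
longer prefix ends in a truncated tile with base `j`; this has length at most `L`, as `j` is the
last occurrence, and so is a border. -/
theorem IsLsf.isLuf_of_lt {i L j l : ℕ} (h : IsLsf f N i L j) (hl : IsLuf f N j l) (hLl : L < l) :
    IsLuf f N i (j + l - i) := by
  have hij := h.lt
  have hlN := hl.le
  refine ⟨by omega, by omega, fun k hk hkl hb => ?_, fun m hm hmN hu => ?_⟩
  · have hkL := h.le_of_agree (by omega) (by omega) hb
    refine hl.unbordered.not_agree (k := k) (x := j + l - k) hk (by omega) (by omega) ?_
    refine (h.agree.symm.mono hkL).trans ?_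
    rwa [show i + (j + l - i) - k = j + l - k by omega] at hb
  · obtain ⟨c, c1, c2, c3, c4, -⟩ := hl.tiles_self.exists_suffix (e := i + m) (by omega) hmN
    have hcL : i + m - c ≤ L := by
      by_contra hlt
      exact h.last c (by omega) (by omega) (h.agree.trans (c4.symm.mono (by omega)))
    exact hu.not_agree (k := i + m - c) (x := c) (by omega) (by omega) (by omega)
      ((h.agree.mono hcL).trans c4.symm)

/-- `q` is the left end of the longest tiling of a segment that ends at `p`, by prefixes of length at
most `m` of the suffix at `p`. -/
structure IsHook (f : ℕ → β) (p m q : ℕ) : Prop where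
  pos : 1 ≤ q
  tiles : Tiles f p m q p
  maximal : ∀ k, 0 < k → k ≤ m → k < q → ¬ Agree f (q - k) p k

/-- Being an occurrence of the unbordered factor of `j`, `i` is a cut of the tiling that starts at
the hook. -/
theorem IsLsf.isLuf_of_hook_le {i L j l q : ℕ} (h : IsLsf f N i L j) (hl : IsLuf f N j l)
    (hlL : l ≤ L) (hq : IsHook f j (N - j) q) (hqi : q ≤ i) : IsLuf f N i l := by
  have hij := h.lt
  have hlN := hl.le
  have ha : Agree f i j l := h.agree.mono hlL
  exact isLuf_of_tiles hl.pos (by omega) (hl.unbordered.congr ha.symm)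
    ((((hl.tiles hq.tiles).trans hl.tiles_self).drop hqi (by omega) ha).congr ha.symm)

/-- A border of `[i, q)` would extend the tiling to the left of the hook; a prefix that reaches past
`q` ends in a tile. -/
theorem IsLsf.isLuf_of_lt_hook {i L j l q : ℕ} (hi : 1 ≤ i) (h : IsLsf f N i L j)
    (hl : IsLuf f N j l) (hlL : l ≤ L) (hq : IsHook f j (N - j) q) (hqi : i < q) :
    IsLuf f N i (q - i) := by
  have hij := h.lt
  have hlN := hl.le
  have hLN := h.le
  have hqj := hq.tiles.le
  refine ⟨by omega, by omega, fun k hk hkl hb => ?_, fun m hm hmN hu => ?_⟩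
  · rw [show i + (q - i) - k = q - k by omega] at hb
    have hkL := h.le_of_agree (by omega) (by omega) hb
    exact hq.maximal k hk (by omega) (by omega) (hb.symm.trans (h.agree.mono hkL))
  · obtain ⟨c, c1, c2, c3, c4, -⟩ := ((hl.tiles hq.tiles).trans hl.tiles_self).exists_suffix
      (e := i + m) (by omega) hmN
    exact hu.not_agree (k := i + m - c) (x := c) (by omega) (by omega) (by omega)
      ((h.agree.mono (by omega)).trans c4.symm)

end References

/-! ### From lists and arrays to agreements of letters; the cost of a search. -/

section Translation

variable {α : Type*}

/-- The letter of `w` at position `x`, for `1 ≤ x`. -/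
def letter (w : List α) (x : ℕ) : Option α := w[x - 1]?

theorem factor_eq_iff {w : List α} {i j k : ℕ} (hi : 1 ≤ i) (hj : 1 ≤ j) :
    factor w i k = factor w j k ↔ Agree (letter w) i j k := by
  simp only [factor, Agree, letter]
  constructor
  · intro h t ht
    have := congrArg (fun l => l[t]?) h
    simp only [List.getElem?_take, ht, if_true, List.getElem?_drop] at this
    rwa [show i + t - 1 = i - 1 + t by omega, show j + t - 1 = j - 1 + t by omega]
  · intro h
    apply List.ext_getElem?
    intro t
    simp only [List.getElem?_take, List.getElem?_drop]
    split_ifs with ht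
    · have := h t ht
      rwa [show i + t - 1 = i - 1 + t by omega, show j + t - 1 = j - 1 + t by omega] at this
    · rfl

theorem take_isSuffix_iff {w : List α} {j q k : ℕ} (hj : 1 ≤ j) (hjn : j ≤ w.length)
    (hqn : q ≤ w.length + 1) :
    (k ≤ (w.drop (j - 1)).length ∧ (w.drop (j - 1)).take k <:+ w.take (q - 1)) ↔
      j + k ≤ w.length + 1 ∧ k ≤ q - 1 ∧ (0 < q → Agree (letter w) (q - k) j k) := by
  have key : k ≤ q - 1 → 0 < q → j + k ≤ w.length + 1 →
      ((w.drop (j - 1)).take k <:+ w.take (q - 1) ↔ Agree (letter w) (q - k) j k) := by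
    intro hk hq hjk
    rw [← factor_eq_iff (by omega) hj, List.suffix_iff_eq_drop, factor, factor, List.drop_take]
    simp only [List.length_take, List.length_drop]
    rw [show min (q - 1) w.length - min k (w.length - (j - 1)) = q - k - 1 by omega,
      show q - 1 - (q - k - 1) = k by omega]
    exact eq_comm
  rcases Nat.eq_zero_or_pos k with rfl | hk0
  · simp only [List.take_zero, List.nil_suffix, Nat.zero_le, true_and, and_true]
    constructor
    · intro _
      exact ⟨by omega, fun _ t ht => by omega⟩
    · simp
  constructor
  · rintro ⟨h1, h2⟩
    have h3 := h2.length_le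
    simp only [List.length_take, List.length_drop] at h1 h3
    have h4 : k ≤ q - 1 := by omega
    exact ⟨by omega, h4, fun hq => (key h4 hq (by omega)).1 h2⟩
  · rintro ⟨h1, h2, h3⟩
    refine ⟨by simp only [List.length_drop]; omega, (key h2 (by omega) h1).2 (h3 (by omega))⟩

variable [DecidableEq α]

theorem lsf_spec {w : List α} {i : ℕ} (hi : 1 ≤ i) (h : lsfLength w i ≠ 0) :
    IsLsf (letter w) (w.length + 1) i (lsfLength w i) (lsfRef w i) := by
  have h1 : OccursLater w i (lsfLength w i) := Nat.findGreatest_of_ne_zero rfl h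
  have hmax : ∀ L, lsfLength w i < L → L ≤ w.length → ¬ OccursLater w i L :=
    fun L => Nat.findGreatest_is_greatest
  have href : lsfRef w i =
      Nat.findGreatest (fun j : ℕ => RepeatsAt w i j (lsfLength w i)) w.length := if_neg h
  obtain ⟨k, hk, hk'⟩ := h1
  rw [Finset.mem_Icc] at hk
  have h2 := Nat.findGreatest_spec (P := fun j : ℕ => RepeatsAt w i j (lsfLength w i)) hk.2 hk'
  have hlast := fun j => Nat.findGreatest_is_greatest
    (P := fun j : ℕ => RepeatsAt w i j (lsfLength w i)) (n := w.length) (k := j)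
  rw [← href] at h2 hlast
  obtain ⟨h3, h4, h5, h6⟩ := h2
  refine ⟨h3, by omega, h5, (factor_eq_iff hi (by omega)).1 h6, fun j' L' h7 h8 h9 h10 => ?_,
    fun j' h7 h8 h9 => ?_⟩
  · exact hmax L' h8 (by omega) ⟨j', Finset.mem_Icc.2 ⟨by omega, by omega⟩, h7, by omega, h9,
      (factor_eq_iff hi (by omega)).2 h10⟩
  · exact hlast j' h7 (by omega) ⟨by omega, by omega, h8, (factor_eq_iff hi (by omega)).2 h9⟩

theorem not_agree_of_lsfLength_eq_zero {w : List α} {i : ℕ} (hi : 1 ≤ i) (h : lsfLength w i = 0)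
    {j L : ℕ} (hij : i < j) (hL : 0 < L) (hj : j + L ≤ w.length + 1) :
    ¬ Agree (letter w) i j L := by
  intro ha
  refine Nat.findGreatest_is_greatest (P := fun k : ℕ => OccursLater w i k) (n := w.length) (k := L)
    ?_ (by omega) ⟨j, Finset.mem_Icc.2 ⟨by omega, by omega⟩, hij, by omega, hj,
      (factor_eq_iff hi (by omega)).2 ha⟩
  change lsfLength w i < L
  omega

/-- The test made by the algorithm depends only on the word once `luf j` is correct. -/
theorem isPotentialReference_iff {w : List α} {luf : ℕ → ℕ} {j : ℕ} (hj : 1 ≤ j)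
    (hl : IsLuf (letter w) (w.length + 1) j (luf j)) :
    IsPotentialReference w luf j ↔ IsReference (letter w) (w.length + 1) j := by
  constructor
  · rintro ⟨i, hi, h1, h2⟩
    rw [Finset.mem_Icc] at hi
    have h0 : lsfLength w i ≠ 0 := by
      intro h0
      have : lsfRef w i = 0 := if_pos h0
      omega
    have h3 := lsf_spec hi.1 h0
    rw [h1] at h3
    exact ⟨i, _, _, hi.1, h3, hl, h2⟩
  · rintro ⟨i, L, l, hi, hlsf, hluf, hle⟩
    obtain rfl := hluf.unique hl
    have h0 : lsfLength w i ≠ 0 := fun h0 =>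
      not_agree_of_lsfLength_eq_zero hi h0 hlsf.lt hlsf.pos hlsf.le hlsf.agree
    obtain ⟨rfl, rfl⟩ := hlsf.unique (lsf_spec hi h0)
    have h1 := hlsf.lt
    have h2 := hlsf.le
    exact ⟨i, Finset.mem_Icc.2 ⟨hi, by omega⟩, rfl, hle⟩

/-- Since `d + 1` doubles per round, `t` rounds multiply it by `2 ^ (t - 1)` before the last
comparison. A success has `d ≤ β` there; in a failure after at least one query, the preceding `d`
was still within the word lengths, whence the factor 4. -/
theorem findBetaLoop_spec (x y : List α) (d : ℕ) (hd : 0 < d) :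
    ((findBetaLoop x y d).1 = 0 ∧
      (∀ k, d ≤ k → ¬ (k ≤ x.length ∧ x.take k <:+ y)) ∧
      ((findBetaLoop x y d).2 = 1 ∨
        2 ^ (findBetaLoop x y d).2 * (d + 1) ≤ 4 * (min x.length y.length + 1))) ∨
    (d ≤ (findBetaLoop x y d).1 ∧
      ((findBetaLoop x y d).1 ≤ x.length ∧ x.take (findBetaLoop x y d).1 <:+ y) ∧
      (∀ k, d ≤ k → k < (findBetaLoop x y d).1 → ¬ (k ≤ x.length ∧ x.take k <:+ y)) ∧
      2 ^ (findBetaLoop x y d).2 * (d + 1) ≤ 2 * ((findBetaLoop x y d).1 + 1)) := by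
  fun_induction findBetaLoop x y d with
  | case1 d h hne =>
    right
    have h1 := Finset.min'_mem _ hne
    have h2 : ∀ k ∈ prefixSuffixQuery d x y, (prefixSuffixQuery d x y).min' hne ≤ k :=
      fun k hk => Finset.min'_le _ k hk
    generalize (prefixSuffixQuery d x y).min' hne = b at h1 h2 ⊢
    rw [prefixSuffixQuery, Finset.mem_filter, Finset.mem_Icc] at h1
    refine ⟨h1.1.1, h1.2, fun k hk (hkb : k < b) hkx => ?_, by dsimp only; omega⟩
    have := h2 k (by rw [prefixSuffixQuery, Finset.mem_filter, Finset.mem_Icc]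
                     exact ⟨⟨hk, by omega⟩, hkx⟩)
    omega
  | case2 d h hne r ih =>
    have hq : ∀ k, d ≤ k → k ≤ 2 * d → ¬ (k ≤ x.length ∧ x.take k <:+ y) := by
      intro k hk hkd hkx
      exact hne ⟨k, by simp only [prefixSuffixQuery, Finset.mem_filter, Finset.mem_Icc]
                       exact ⟨⟨hk, hkd⟩, hkx⟩⟩
    rcases ih (by omega) with ⟨h1, h2, h3⟩ | ⟨h1, h2, h3, h4⟩
    · left
      refine ⟨h1, fun k hk => ?_, Or.inr ?_⟩
      · rcases le_or_gt k (2 * d) with h5 | h5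
        · exact hq k hk h5
        · exact h2 k h5
      · change 2 ^ (r.2 + 1) * (d + 1) ≤ _
        rcases h3 with h3 | h3
        · change r.2 = 1 at h3
          rw [h3]
          omega
        · change 2 ^ r.2 * _ ≤ _ at h3
          calc 2 ^ (r.2 + 1) * (d + 1) = 2 ^ r.2 * (2 * d + 1 + 1) := by ring
            _ ≤ _ := h3
    · right
      refine ⟨?_, h2, fun k hk hkb => ?_, ?_⟩
      · change d ≤ r.1
        change 2 * d + 1 ≤ r.1 at h1
        omega
      · rcases le_or_gt k (2 * d) with h5 | h5
        · exact hq k hk h5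
        · exact h3 k h5 hkb
      · calc 2 ^ (r.2 + 1) * (d + 1) = 2 ^ r.2 * (2 * d + 1 + 1) := by ring
          _ ≤ _ := h4
  | case3 d h =>
    left
    refine ⟨rfl, fun k hk ⟨h1, h2⟩ => h ?_, Or.inl rfl⟩
    have := h2.length_le
    rw [List.length_take] at this
    omega

theorem findBeta_spec {w : List α} (l : ℕ) {q j : ℕ} (hj : 1 ≤ j) (hjn : j ≤ w.length)
    (hq : 1 ≤ q) (hqn : q ≤ w.length + 1) :
    ((findBeta w l q j).1 = 0 ∧
      (∀ k, 2 * l < k → j + k ≤ w.length + 1 → k < q → ¬ Agree (letter w) (q - k) j k) ∧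
      2 ^ (findBeta w l q j).2 ≤ 2 * (w.length + 1)) ∨
    (2 * l < (findBeta w l q j).1 ∧ j + (findBeta w l q j).1 ≤ w.length + 1 ∧
      (findBeta w l q j).1 < q ∧
      Agree (letter w) (q - (findBeta w l q j).1) j (findBeta w l q j).1 ∧
      (∀ k, 2 * l < k → k < (findBeta w l q j).1 → ¬ Agree (letter w) (q - k) j k) ∧
      2 ^ (findBeta w l q j).2 * (l + 1) ≤ (findBeta w l q j).1 + 1) := by
  have h := findBetaLoop_spec (w.drop (j - 1)) (w.take (q - 1)) (2 * l + 1) (by omega)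
  simp only [take_isSuffix_iff hj hjn hqn] at h
  change ((findBeta w l q j).1 = 0 ∧ _ ∧ ((findBeta w l q j).2 = 1 ∨
    2 ^ (findBeta w l q j).2 * _ ≤ _)) ∨ (_ ≤ (findBeta w l q j).1 ∧
    (j + (findBeta w l q j).1 ≤ _ ∧ (findBeta w l q j).1 ≤ _ ∧
      (_ → Agree _ (q - (findBeta w l q j).1) j (findBeta w l q j).1)) ∧
    (∀ k, _ → k < (findBeta w l q j).1 → _) ∧ 2 ^ (findBeta w l q j).2 * _ ≤
      2 * ((findBeta w l q j).1 + 1)) at h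
  generalize findBeta w l q j = r at *
  rcases h with ⟨h1, h2, h3⟩ | ⟨h1, ⟨h2, h3, h4⟩, h5, h6⟩
  · refine Or.inl ⟨h1, fun k hk hkj hkq ha => h2 k (by omega) ⟨hkj, by omega, fun _ => ha⟩, ?_⟩
    rcases h3 with h3 | h3
    · rw [h3]; omega
    · simp only [List.length_drop, List.length_take] at h3
      have : 2 ^ r.2 * 2 ≤ 2 ^ r.2 * (2 * l + 1 + 1) := Nat.mul_le_mul_left _ (by omega)
      omega
  · refine Or.inr ⟨by omega, h2, by omega, h4 (by omega), fun k hk hkb ha =>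
      h5 k (by omega) hkb ⟨by omega, by omega, fun _ => ha⟩, ?_⟩
    have : 2 ^ r.2 * (2 * l + 1 + 1) = 2 * (2 ^ r.2 * (l + 1)) := by ring
    omega

end Translation

/-! ### Correctness of `FindHook`. -/

section Invariant

variable {α : Type*}

/-- The state of the memory after the positions from `i` on have been processed. -/
structure Inv (w : List α) (i : ℕ) (s : State) : Prop where
  sound : ∀ p, 1 ≤ p → p < i → 0 < s.len p → ∃ k, IsReference (letter w) (w.length + 1) k ∧ i ≤ k ∧
    Piece (letter w) (w.length + 1) p (s.len p) k
  complete : ∀ p, 1 ≤ p → p < i → ∀ k l, IsReference (letter w) (w.length + 1) k → i ≤ k →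
    Piece (letter w) (w.length + 1) p l k → l ≤ s.len p
  hook : ∀ p, 1 ≤ p → p < i → IsHook (letter w) p (s.len p) (s.hook p)
  luf : ∀ j, i ≤ j → j < w.length + 1 → IsLuf (letter w) (w.length + 1) j (s.luf j)
  hook_ref : ∀ j, i ≤ j → j < w.length + 1 → IsReference (letter w) (w.length + 1) j →
    IsHook (letter w) j (w.length + 1 - j) (s.hook j)
  len_lt : ∀ p, 1 ≤ p → p ≤ w.length → s.len p < w.length

variable {w : List α} {j : ℕ} {s₀ : State}

theorem Inv.exists_piece (h : Inv w (j + 1) s₀) (hj : 1 ≤ j) (hl : 0 < s₀.len j) :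
    ∃ k, IsReference (letter w) (w.length + 1) k ∧ j + 1 ≤ k ∧
      Piece (letter w) (w.length + 1) j (s₀.len j) k :=
  h.sound j hj (by omega) hl

/-- A position that `FindHook(j)` pushes and the position `j` have last been pushed with the same
length. -/
theorem Inv.len_eq (h : Inv w (j + 1) s₀) (hj : 1 ≤ j)
    (hr : IsReference (letter w) (w.length + 1) j) {p b : ℕ} (hp : 1 ≤ p)
    (hb : Piece (letter w) (w.length + 1) p b j) (hlb : s₀.len j < b) : s₀.len p = s₀.len j := by
  have hpj := hb.lt
  have hbN := hb.le
  apply le_antisymm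
  -- If `len p` were larger, an unbordered word longer than `len j` would start at `p`, `j` and `k`,
  -- and the two tilings from `p` would produce a tile at `j` that contradicts completeness.
  · by_contra hlt
    obtain ⟨k, hk, hjk, hpk⟩ := h.sound p hp (by omega) (by omega)
    have hkN := hpk.le
    have hm : s₀.len j < min b (s₀.len p) := by omega
    have hmb := min_le_left b (s₀.len p)
    have hmp := min_le_right b (s₀.len p)
    have hu : Unbordered (letter w) p (min b (s₀.len p)) := by
      rcases min_choice b (s₀.len p) with h1 | h1
      · rw [h1]; exact hb.unbordered.congr hb.agree.symm
      · rw [h1]; exact hpk.unbordered.congr hpk.agree.symm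
    have haj := hb.agree.mono hmb
    have hak := hpk.agree.mono hmp
    generalize min b (s₀.len p) = m at *
    obtain ⟨k', h1, h2, h3, h4⟩ := exists_tiles_of_common_cut (by omega) (j - p) p k le_rfl
      (by omega) (by omega) (by omega) hu haj hak hpk.tiles_self hb.tiles_self
    obtain ⟨l', h5, h6⟩ := exists_piece_ge h4 h1 h2 (hu.congr (haj.trans h3)) h3
    obtain ⟨k'', l'', h7, h8, h9⟩ := exists_isReference_piece hr h6
    have h10 := h9.lt
    have h11 := h9.pos
    have := h.complete j hj (by omega) k'' l'' h8 (by omega) h9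
    omega
  · rcases Nat.eq_zero_or_pos (s₀.len j) with h0 | h0
    · omega
    obtain ⟨k, hk, hjk, hpk⟩ := h.exists_piece hj h0
    have hkN := hpk.le
    -- Conversely, the tilings of `[p, j)` and `[j, k)` join to one with base `k`.
    have ht := (hpk.tiles_self.rebase_suffix (by omega) hb.tiles_self).trans hpk.tiles_self
    obtain ⟨l', h1, h2⟩ := exists_piece_ge ht (by omega) hkN hpk.unbordered
      ((hb.agree.mono hlb.le).trans hpk.agree)
    exact h1.trans (h.complete p hp (by omega) k l' hk hjk h2)

/-- The positions that `FindHook(j)` skips need no update. -/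
theorem Inv.le_len_of_skipped (h : Inv w (j + 1) s₀) (hj : 1 ≤ j) {q p' p l : ℕ} (hp : 1 ≤ p)
    (hqp : q ≤ p) (hpp : p < p') (hp'j : p' ≤ j) (ht : Tiles (letter w) j (s₀.len j) q p')
    (ht' : Tiles (letter w) j (w.length + 1 - j) p' j)
    (hl : Piece (letter w) (w.length + 1) p l j) : l ≤ s₀.len p := by
  have hlN := hl.le
  obtain ⟨e, k, h1, h2, h3, h4, h5, h6, -, h8⟩ := ht.locate hqp hpp
  have h9 := h8.le
  obtain ⟨kk, hk, hjk, hpk⟩ := h.exists_piece hj (by omega)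
  have hkN := hpk.le
  have hpj := hpk.lt
  -- If `p` were strictly inside a tile of the skipped stretch, its own tiling would give that tile
  -- a border. So `p` is a cut, and the tile is unique.
  have hlk : l = k := by
    rcases h2.eq_or_lt with rfl | h2
    · refine hl.unique ⟨by omega, ?_, h5, h6, (h8.mono ?_).trans ht'⟩ <;> omega
    · obtain ⟨c, c1, c2, c3, c4, -⟩ := hl.tiles_self.exists_suffix (e := e + k) (by omega)
        (by omega)
      exact (h5.not_agree (k := e + k - c) (x := j + (c - e)) (by omega) (by omega) (by omega)
        (c4.symm.trans (h6.sub (by omega) (by omega) (by omega)))).elim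
  subst hlk
  have ha := hpk.agree.mono h4
  refine h.complete p hp (by omega) kk l hk hjk ⟨hl.pos, by omega, hl.unbordered.congr ha,
    hl.agree.trans ha, ?_⟩
  exact (hpk.tiles_self.rebase_suffix (by omega) hl.tiles).trans hpk.tiles_self

/-- The search of `FindBeta` may start after twice the length with which `j` was last pushed. -/
theorem Inv.not_agree_of_le (h : Inv w (j + 1) s₀) (hj : 1 ≤ j) {q : ℕ}
    (hs : ∀ k, 0 < k → k ≤ s₀.len j → k < q → ¬ Agree (letter w) (q - k) j k) :
    ∀ k, 0 < k → k ≤ 2 * s₀.len j → k < q → ¬ Agree (letter w) (q - k) j k := by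
  intro k hk0 hk hkq ha
  rcases le_or_gt k (s₀.len j) with h1 | h1
  · exact hs k hk0 h1 hkq ha
  obtain ⟨kk, -, hjk, hpk⟩ := h.exists_piece hj (by omega)
  have h2 := hpk.lt
  have h3 := hpk.le
  -- A prefix with length between `len j` and `2 * len j` ends, after the first tile at `j`, in a
  -- truncated tile of length at most `len j`; by the first case this cannot end at `q`.
  obtain ⟨c, c1, c2, c3, c4, -⟩ :=
    (hpk.tiles.extend (e := j + k) (by omega) (by omega)).exists_suffix (by omega) le_rfl
  refine hs (j + k - c) (by omega) (by omega) (by omega) ?_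
  refine ((ha.sub (y := c) (by omega) (by omega) (by omega)).trans c4).trans ?_
  exact (hpk.agree.mono (by omega)).symm

/-- As the stack is sorted, stopping at the first long pair removes exactly the pairs shorter than
`B`. -/
theorem handlePopping_spec (q : ℕ) (B : ℕ∞) (st : List (ℕ × ℕ)) (hook : ℕ → ℕ)
    (hst : st.Pairwise fun a b => a.1 ≤ b.1) :
    (∀ a ∈ (handlePopping q B st hook).1, a ∈ st ∧ B ≤ a.1) ∧
    (∀ a ∈ st, B ≤ a.1 → a ∈ (handlePopping q B st hook).1) ∧
    (handlePopping q B st hook).1.Pairwise (fun a b => a.1 ≤ b.1) ∧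
    (∀ p, ((handlePopping q B st hook).2 p = hook p ∧ ∀ a ∈ st, (a.1 : ℕ∞) < B → a.2 ≠ p) ∨
      ((handlePopping q B st hook).2 p = q ∧ ∃ a ∈ st, (a.1 : ℕ∞) < B ∧ a.2 = p)) := by
  induction st generalizing hook with
  | nil => simp [handlePopping]
  | cons a st ih =>
    obtain ⟨l, p⟩ := a
    rw [List.pairwise_cons] at hst
    unfold handlePopping
    split_ifs with hl
    · obtain ⟨h1, h2, h3, h4⟩ := ih (Function.update hook p q) hst.2
      refine ⟨fun a ha => ⟨List.mem_cons_of_mem _ (h1 a ha).1, (h1 a ha).2⟩, ?_, h3, fun x => ?_⟩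
      · intro a ha hB
        rcases List.mem_cons.1 ha with rfl | ha
        · exact absurd hl (not_lt.2 hB)
        · exact h2 a ha hB
      · rcases h4 x with ⟨h5, h6⟩ | ⟨h5, a, h6, h7⟩
        · rcases eq_or_ne p x with rfl | hne
          · right
            exact ⟨by rw [h5, Function.update_self], _, List.mem_cons_self, hl, rfl⟩
          · left
            refine ⟨by rw [h5, Function.update_of_ne hne.symm], fun a ha haB => ?_⟩
            rcases List.mem_cons.1 ha with rfl | ha
            · exact hne
            · exact h6 a ha haB
        · exact Or.inr ⟨h5, a, List.mem_cons_of_mem _ h6, h7⟩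
    · have hall : ∀ a ∈ (l, p) :: st, B ≤ a.1 := by
        intro a ha
        rcases List.mem_cons.1 ha with rfl | ha
        · exact not_lt.1 hl
        · exact (not_lt.1 hl).trans (by exact_mod_cast hst.1 a ha)
      exact ⟨fun a ha => ⟨ha, hall a ha⟩, fun a ha _ => ha, List.pairwise_cons.2 hst,
        fun x => Or.inl ⟨rfl, fun a ha hB => absurd hB (not_lt.2 (hall a ha))⟩⟩

/-- The invariant of the loop of `FindHook(j)`, which starts in the state `s₀`. -/
structure LoopInv (w : List α) (j : ℕ) (s₀ : State) (st : List (ℕ × ℕ)) (q : ℕ) (s : State) :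
    Prop where
  pos : 1 ≤ q
  tiles : Tiles (letter w) j (w.length + 1 - j) q j
  not_agree : ∀ k, 0 < k → k ≤ s₀.len j → k < q → ¬ Agree (letter w) (q - k) j k
  low : ∀ p, p < q ∨ j ≤ p → s.len p = s₀.len p ∧ s.hook p = s₀.hook p
  luf : s.luf = s₀.luf
  sound : ∀ p, q ≤ p → p < j → 0 < s.len p → ∃ k, IsReference (letter w) (w.length + 1) k ∧ j ≤ k ∧
    Piece (letter w) (w.length + 1) p (s.len p) k
  complete : ∀ p, q ≤ p → p < j → ∀ k l, IsReference (letter w) (w.length + 1) k → j ≤ k →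
    Piece (letter w) (w.length + 1) p l k → l ≤ s.len p
  hook : ∀ p, q ≤ p → p < j → (s.len p, p) ∈ st ∨ IsHook (letter w) p (s.len p) (s.hook p)
  stack : ∀ a ∈ st, q ≤ a.2 ∧ a.2 < j ∧ s.len a.2 = a.1 ∧ j + a.1 ≤ w.length + 1 ∧
    Agree (letter w) a.2 j a.1 ∧ Tiles (letter w) j a.1 q a.2
  sorted : st.Pairwise fun a b => a.1 ≤ b.1
  len_lt : ∀ p, 1 ≤ p → p ≤ w.length → s.len p < w.length

/-- The stored hook already accounts for the tiles of length at most `len j`; the positions between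
it and `j` are skipped ones. -/
theorem Inv.loopInv_start (h : Inv w (j + 1) s₀) (hj : 1 ≤ j) (hjn : j ≤ w.length) :
    LoopInv w j s₀ [] (s₀.hook j) s₀ := by
  have hh := h.hook j hj (by omega)
  have hlN : j + s₀.len j ≤ w.length + 1 := by
    rcases Nat.eq_zero_or_pos (s₀.len j) with h0 | h0
    · omega
    · obtain ⟨k, -, hjk, hpk⟩ := h.exists_piece hj h0
      have := hpk.le
      omega
  have hhpos := hh.pos
  refine ⟨hh.pos, hh.tiles.mono (by omega), hh.maximal, fun p _ => ⟨rfl, rfl⟩, rfl, ?_, ?_, ?_,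
    fun a ha => by simp at ha, List.Pairwise.nil, h.len_lt⟩
  · intro p hqp hpj hl
    obtain ⟨k, h1, h2, h3⟩ := h.sound p (by omega) (by omega) hl
    exact ⟨k, h1, by omega, h3⟩
  · intro p hqp hpj k l hk hjk hl
    rcases hjk.eq_or_lt with rfl | hjk
    · exact h.le_len_of_skipped hj (by omega) hqp hpj le_rfl hh.tiles (.nil _) hl
    · exact h.complete p (by omega) (by omega) k l hk hjk hl
  · intro p hqp hpj
    exact Or.inr (h.hook p (by omega) (by omega))

/-- Popping at `q` sets the hooks correctly. -/
theorem LoopInv.isHook_of_mem {st : List (ℕ × ℕ)} {q : ℕ} {s : State} (hL : LoopInv w j s₀ st q s)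
    {a : ℕ × ℕ} (ha : a ∈ st)
    (hs : ∀ k, 0 < k → k ≤ a.1 → k < q → ¬ Agree (letter w) (q - k) j k) :
    IsHook (letter w) a.2 a.1 q := by
  obtain ⟨h1, h2, h3, h4, h5, h6⟩ := hL.stack a ha
  exact ⟨hL.pos, h6.congr h5.symm, fun k hk hka hkq hag =>
    hs k hk hka hkq (hag.trans (h5.mono hka))⟩

/-- The hooks after popping all pairs of length less than `B` at `q`. -/
theorem LoopInv.hook_pop {st : List (ℕ × ℕ)} {q : ℕ} {s : State} (hL : LoopInv w j s₀ st q s)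
    {B : ℕ∞}
    (hs : ∀ k : ℕ, 0 < k → j + k ≤ w.length + 1 → (k : ℕ∞) < B → k < q →
      ¬ Agree (letter w) (q - k) j k) {p : ℕ} (hqp : q ≤ p) (hpj : p < j) :
    (s.len p, p) ∈ (handlePopping q B st s.hook).1 ∨
      IsHook (letter w) p (s.len p) ((handlePopping q B st s.hook).2 p) := by
  obtain ⟨h1, h2, -, h4⟩ := handlePopping_spec q B st s.hook hL.sorted
  have key : ∀ a ∈ st, (a.1 : ℕ∞) < B → a.2 = p → IsHook (letter w) p (s.len p) q := by
    rintro a ha haB rfl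
    obtain ⟨-, -, h5, h6, -, -⟩ := hL.stack a ha
    rw [h5]
    exact hL.isHook_of_mem ha fun k hk hka hkq =>
      hs k hk (by omega) (lt_of_le_of_lt (by exact_mod_cast hka) haB) hkq
  rcases h4 p with ⟨h5, h6⟩ | ⟨h5, a, ha, haB, hap⟩
  · rcases hL.hook p hqp hpj with h7 | h7
    · left
      refine h2 _ h7 (not_lt.1 fun hB => h6 _ h7 hB rfl)
    · right
      rwa [h5]
  · right
    rw [h5]
    exact key a ha haB hap

theorem LoopInv.hook_low {st : List (ℕ × ℕ)} {q : ℕ} {s : State} (hL : LoopInv w j s₀ st q s)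
    (B : ℕ∞) {p : ℕ} (hp : p < q ∨ j ≤ p) :
    (handlePopping q B st s.hook).2 p = s₀.hook p := by
  obtain ⟨-, -, -, h4⟩ := handlePopping_spec q B st s.hook hL.sorted
  rcases h4 p with ⟨h5, -⟩ | ⟨-, a, ha, -, hap⟩
  · rw [h5, (hL.low p hp).2]
  · obtain ⟨h1, h2, -⟩ := hL.stack a ha
    omega

/-- The last round of `FindHook(j)`. -/
theorem LoopInv.finish {st : List (ℕ × ℕ)} {q : ℕ} {s : State} (hL : LoopInv w j s₀ st q s)
    (hs : ∀ k, 0 < k → j + k ≤ w.length + 1 → k < q → ¬ Agree (letter w) (q - k) j k) (t : ℕ) :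
    LoopInv w j s₀ [] q
      { s with hook := (handlePopping q ⊤ st s.hook).2, betaTime := t } := by
  refine ⟨hL.pos, hL.tiles, hL.not_agree, fun p hp => ⟨(hL.low p hp).1, hL.hook_low ⊤ hp⟩, hL.luf,
    hL.sound, hL.complete, fun p hqp hpj => Or.inr ?_, fun a ha => by simp at ha,
    List.Pairwise.nil, hL.len_lt⟩
  rcases hL.hook_pop (B := ⊤) (fun k hk hjk _ hkq => hs k hk hjk hkq) hqp hpj with h1 | h1
  · have h2 := ((handlePopping_spec q ⊤ st s.hook hL.sorted).1 _ h1).2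
    exact absurd h2 (not_le.2 (ENat.natCast_lt_top _))
  · exact h1

/-- The shortest prefix found at `q` is a tile. -/
theorem LoopInv.piece {st : List (ℕ × ℕ)} {q b : ℕ} {s : State} (hL : LoopInv w j s₀ st q s)
    (hb : 0 < b) (hbq : b < q) (hbN : j + b ≤ w.length + 1) (ha : Agree (letter w) (q - b) j b)
    (hs : ∀ k, 0 < k → k < b → ¬ Agree (letter w) (q - k) j k) :
    Piece (letter w) (w.length + 1) (q - b) b j := by
  -- A border of the shortest prefix would be a shorter prefix ending at `q`.
  refine ⟨hb, hbN, fun k hk hkb hag => hs k hk hkb ?_, ha, ?_⟩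
  · exact (ha.sub (x := q - k) (y := j + b - k) (by omega) (by omega) (by omega)).trans hag.symm
  · rw [show q - b + b = q by omega]
    exact hL.tiles

/-- A round of `FindHook(j)` that pushes a pair. -/
theorem LoopInv.step {st : List (ℕ × ℕ)} {q b : ℕ} {s : State} (hI : Inv w (j + 1) s₀) (hj : 1 ≤ j)
    (hjn : j ≤ w.length) (hr : IsReference (letter w) (w.length + 1) j)
    (hL : LoopInv w j s₀ st q s) (hb : 2 * s₀.len j < b) (hbq : b < q)
    (hbN : j + b ≤ w.length + 1) (ha : Agree (letter w) (q - b) j b)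
    (hs : ∀ k, 0 < k → k < b → ¬ Agree (letter w) (q - k) j k)
    (pu : ℕ → List (ℕ × ℕ)) (t : ℕ) :
    s.len (q - b) = s₀.len j ∧
    (handlePopping q (b : ℕ∞) st s.hook).2 (q - b) < q ∧
    LoopInv w j s₀ ((b, q - b) :: (handlePopping q (b : ℕ∞) st s.hook).1)
      ((handlePopping q (b : ℕ∞) st s.hook).2 (q - b))
      { s with
        hook := (handlePopping q (b : ℕ∞) st s.hook).2
        len := Function.update s.len (q - b) b
        pushed := pu
        betaTime := t } := by
  have hpc := hL.piece (by omega) hbq hbN ha hs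
  have hqj := hL.tiles.le
  -- This makes the hook stored at `q - b` continue the tiling with base `j`.
  have hl₀ := hI.len_eq hj hr (by omega) hpc (by omega)
  have hh := hI.hook (q - b) (by omega) (by omega)
  have hhook := hL.hook_low (b : ℕ∞) (p := q - b) (by omega)
  have hlow := hL.low
  have hle := hh.tiles.le
  have hpos := hh.pos
  rw [hl₀] at hh
  have hag : Agree (letter w) (q - b) j (s₀.len j) := ha.mono (by omega)
  have htl : Tiles (letter w) j (s₀.len j) (s₀.hook (q - b)) (q - b) := hh.tiles.congr hag
  obtain ⟨hp1, hp2, hp3, hp4⟩ := handlePopping_spec q (b : ℕ∞) st s.hook hL.sorted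
  have hpop := fun p (hqp : q ≤ p) (hpj : p < j) => hL.hook_pop (B := (b : ℕ∞))
    (fun k hk _ hkb hkq => hs k hk (by exact_mod_cast hkb)) hqp hpj
  have hplow := fun p (hp : p < q ∨ j ≤ p) => hL.hook_low (b : ℕ∞) hp
  generalize handlePopping q (b : ℕ∞) st s.hook = r at *
  rw [hhook]
  refine ⟨by rw [(hlow _ (by omega)).1, hl₀], by omega, hpos, ?_, ?_, ?_, hL.luf, ?_, ?_, ?_, ?_,
    ?_, ?_⟩
  · exact (htl.mono (by omega)).trans hpc.tiles_self
  · exact fun k hk hkl hkq hak => hh.maximal k hk hkl hkq (hak.trans (hag.mono hkl).symm)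
  · intro p hp
    refine ⟨?_, hplow p (by omega)⟩
    change Function.update s.len (q - b) b p = _
    rw [Function.update_of_ne (by omega), (hlow p (by omega)).1]
  · intro p hqp hpj
    change 0 < Function.update s.len (q - b) b p → ∃ k, _ ∧ _ ∧
      Piece _ _ p (Function.update s.len (q - b) b p) k
    rcases eq_or_ne p (q - b) with rfl | hne
    · rw [Function.update_self]
      exact fun _ => ⟨j, hr, le_rfl, hpc⟩
    · rw [Function.update_of_ne hne]
      intro hl
      rcases lt_or_ge p q with hpq | hpq
      · rw [(hlow p (Or.inl hpq)).1] at hl ⊢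
        obtain ⟨k, h1, h2, h3⟩ := hI.sound p (by omega) (by omega) hl
        exact ⟨k, h1, by omega, h3⟩
      · exact hL.sound p hpq hpj hl
  · intro p hqp hpj k l hk hjk hl
    change l ≤ Function.update s.len (q - b) b p
    rcases eq_or_ne p (q - b) with rfl | hne
    · rw [Function.update_self]
      rcases hjk.eq_or_lt with rfl | hjk
      · exact (hl.unique hpc).le
      · have := hI.complete (q - b) (by omega) (by omega) k l hk hjk hl
        omega
    · rw [Function.update_of_ne hne]
      rcases lt_or_ge p q with hpq | hpq
      · rw [(hlow p (Or.inl hpq)).1]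
        rcases hjk.eq_or_lt with rfl | hjk
        · rcases lt_or_ge p (q - b) with h1 | h1
          · exact hI.le_len_of_skipped hj (by omega) hqp h1 (by omega) htl hpc.tiles_self hl
          -- A position strictly between `q - b` and `q` has no tile with base `j`: its tiling, cut
          -- at `q`, would end in a prefix shorter than `b`.
          · obtain ⟨c, c1, c2, c3, c4, -⟩ := hl.tiles_self.exists_suffix hpq hqj
            refine (hs (q - c) (by omega) (by omega) ?_).elim
            rwa [show q - (q - c) = c by omega]
        · exact hI.complete p (by omega) (by omega) k l hk hjk hl
      · exact hL.complete p hpq hpj k l hk hjk hl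
  · intro p hqp hpj
    change (Function.update s.len (q - b) b p, p) ∈ _ ∨
      IsHook _ p (Function.update s.len (q - b) b p) (r.2 p)
    rcases eq_or_ne p (q - b) with rfl | hne
    · rw [Function.update_self]
      exact Or.inl List.mem_cons_self
    · rw [Function.update_of_ne hne]
      rcases lt_or_ge p q with hpq | hpq
      · rw [(hlow p (Or.inl hpq)).1, hplow p (Or.inl hpq)]
        exact Or.inr (hI.hook p (by omega) (by omega))
      · exact (hpop p hpq hpj).imp (List.mem_cons_of_mem _) id
  · intro a haa
    change _ ∧ _ ∧ Function.update s.len (q - b) b a.2 = a.1 ∧ _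
    rcases List.mem_cons.1 haa with rfl | haa
    · exact ⟨hle, by dsimp only; omega, Function.update_self .., hbN, ha, htl.mono (by omega)⟩
    · obtain ⟨h1, h2⟩ := hp1 a haa
      have h2 : b ≤ a.1 := by exact_mod_cast h2
      obtain ⟨h3, h4, h5, h6, h7, h8⟩ := hL.stack a h1
      refine ⟨by omega, h4, by rw [Function.update_of_ne (by omega), h5], h6, h7, ?_⟩
      refine (htl.mono (by omega)).trans (.cons b (by omega) h2 hpc.unbordered ha ?_)
      rwa [show q - b + b = q by omega]
  · refine List.pairwise_cons.2 ⟨fun a haa => ?_, hp3⟩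
    exact_mod_cast (hp1 a haa).2
  · intro p hp hpn
    change Function.update s.len (q - b) b p < _
    rcases eq_or_ne p (q - b) with rfl | hne
    · rw [Function.update_self]; omega
    · rw [Function.update_of_ne hne]
      exact hL.len_lt p hp hpn

end Invariant

/-! ### Amortization and the main loop. -/

section Counting

/-- The potential that pays for the stacks and for the successful searches. -/
def potential (n : ℕ) (len : ℕ → ℕ) : ℕ := ∑ p ∈ Finset.Icc 1 n, Nat.log 2 (len p + 1)

theorem potential_update {n p b : ℕ} (len : ℕ → ℕ) (hp : 1 ≤ p) (hpn : p ≤ n) :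
    potential n (Function.update len p b) + Nat.log 2 (len p + 1) =
      potential n len + Nat.log 2 (b + 1) := by
  have hmem : p ∈ Finset.Icc 1 n := Finset.mem_Icc.2 ⟨hp, hpn⟩
  simp only [potential]
  rw [← Finset.add_sum_erase _ _ hmem, ← Finset.add_sum_erase (a := p) _ _ hmem,
    Function.update_self]
  have : ∀ x ∈ (Finset.Icc 1 n).erase p,
      Nat.log 2 (Function.update len p b x + 1) = Nat.log 2 (len x + 1) := by
    intro x hx
    rw [Function.update_of_ne (Finset.ne_of_mem_erase hx)]
  rw [Finset.sum_congr rfl this]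
  ring

theorem add_log_le {t l b : ℕ} (h : 2 ^ t * (l + 1) ≤ b + 1) :
    t + Nat.log 2 (l + 1) ≤ Nat.log 2 (b + 1) := by
  refine Nat.le_log_of_pow_le (by omega) ?_
  rw [pow_add]
  exact (Nat.mul_le_mul_left _ (Nat.pow_log_le_self 2 (by omega))).trans h

theorem le_log_of_pow_le_mul {t n : ℕ} (h : 2 ^ t ≤ 2 * (n + 1)) : t ≤ Nat.log 2 (n + 1) + 1 := by
  rcases t with _ | t
  · omega
  · rw [pow_succ] at h
    have := Nat.le_log_of_pow_le (b := 2) (x := t) (y := n + 1) (by omega) (by omega)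
    omega

/-- The strict bound `len p < n` gives `log₂ n`, so the potential vanishes for `n = 1`. -/
theorem potential_le {n : ℕ} {len : ℕ → ℕ} (h : ∀ p, 1 ≤ p → p ≤ n → len p < n) :
    potential n len ≤ n * Nat.log 2 n := by
  have := Finset.sum_le_card_nsmul (Finset.Icc 1 n) (fun p => Nat.log 2 (len p + 1))
    (Nat.log 2 n) fun p hp => by
      rw [Finset.mem_Icc] at hp
      exact Nat.log_mono_right (h p hp.1 hp.2)
  simpa [potential] using this

variable {α : Type*}

theorem totalStackSize_push (w : List α) {j : ℕ} (hj : 1 ≤ j) (hjn : j ≤ w.length) (s : State)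
    (a : ℕ × ℕ) (luf hook len : ℕ → ℕ) (t : ℕ) :
    totalStackSize w ⟨luf, hook, len, Function.update s.pushed j (s.pushed j ++ [a]), t⟩ =
      totalStackSize w s + 1 := by
  have hmem : j ∈ Finset.Icc 1 w.length := Finset.mem_Icc.2 ⟨hj, hjn⟩
  simp only [totalStackSize]
  rw [← Finset.add_sum_erase _ _ hmem, ← Finset.add_sum_erase (a := j) _ _ hmem,
    Function.update_self]
  have : ∀ x ∈ (Finset.Icc 1 w.length).erase j,
      (Function.update s.pushed j (s.pushed j ++ [a]) x).length = (s.pushed x).length := by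
    intro x hx
    rw [Function.update_of_ne (Finset.ne_of_mem_erase hx)]
  rw [Finset.sum_congr rfl this, List.length_append, List.length_singleton]
  ring

theorem Inv.update_luf {w : List α} {j : ℕ} {s₀ : State} (hI : Inv w (j + 1) s₀) (l : ℕ) :
    Inv w (j + 1) { s₀ with luf := Function.update s₀.luf j l } := by
  refine ⟨hI.sound, hI.complete, hI.hook, fun i hi hiN => ?_, hI.hook_ref, hI.len_lt⟩
  change IsLuf _ _ i (Function.update s₀.luf j l i)
  rw [Function.update_of_ne (by omega)]
  exact hI.luf i hi hiN

theorem inv_initialState (w : List α) : Inv w (w.length + 1) initialState := by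
  refine ⟨fun p _ _ h => absurd h (lt_irrefl 0), fun p hp _ k l _ hk hl => ?_, fun p hp _ => ?_,
    fun j h1 h2 => by omega, fun j h1 h2 => by omega, fun p h1 h2 => ?_⟩
  · have := hl.le
    have := hl.pos
    omega
  · exact ⟨hp, .nil _, fun k h1 h2 => absurd h1 (not_lt.2 h2)⟩
  · change 0 < _
    omega

variable [DecidableEq α] {w : List α} {j : ℕ} {s₀ : State}

/-- Pushes and successful searches are paid for by the potential; the additive term is the single
failing search. Each push lowers `q`, so `q < fuel` suffices for termination. -/
theorem findHookLoop_spec (hI : Inv w (j + 1) s₀) (hj : 1 ≤ j) (hjn : j ≤ w.length)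
    (hr : IsReference (letter w) (w.length + 1) j) (fuel : ℕ) :
    ∀ st q s, LoopInv w j s₀ st q s → q < fuel →
      ∃ q' s', findHookLoop w j fuel st q s = some (q', s') ∧ LoopInv w j s₀ [] q' s' ∧
        (∀ k, 0 < k → j + k ≤ w.length + 1 → k < q' → ¬ Agree (letter w) (q' - k) j k) ∧
        s'.betaTime + potential w.length s.len ≤
          s.betaTime + potential w.length s'.len + (Nat.log 2 (w.length + 1) + 1) ∧
        totalStackSize w s' + potential w.length s.len ≤
          totalStackSize w s + potential w.length s'.len := by
  induction fuel with
  | zero => intro st q s _ hq; omega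
  | succ fuel ih =>
    intro st q s hL hq
    have hqj := hL.tiles.le
    have hlj : s.len j = s₀.len j := (hL.low j (Or.inr le_rfl)).1
    have hno := hI.not_agree_of_le hj hL.not_agree
    unfold findHookLoop
    rw [hlj]
    have hβ := findBeta_spec (w := w) (s₀.len j) hj hjn hL.pos (by omega)
    generalize findBeta w (s₀.len j) q j = r at *
    obtain ⟨b, t⟩ := r
    dsimp only at hβ ⊢
    rcases hβ with ⟨rfl, h1, h2⟩ | ⟨h1, h2, h3, h4, h5, h6⟩
    · have hs : ∀ k, 0 < k → j + k ≤ w.length + 1 → k < q → ¬ Agree (letter w) (q - k) j k := by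
        intro k hk hjk hkq
        rcases le_or_gt k (2 * s₀.len j) with h | h
        · exact hno k hk h hkq
        · exact h1 k h hjk hkq
      rw [if_pos rfl]
      refine ⟨_, _, rfl, hL.finish hs _, hs, ?_, le_rfl⟩
      have := le_log_of_pow_le_mul h2
      dsimp only
      omega
    · rw [if_neg (by omega)]
      have hs : ∀ k, 0 < k → k < b → ¬ Agree (letter w) (q - k) j k := by
        intro k hk hkb
        rcases le_or_gt k (2 * s₀.len j) with h | h
        · exact hno k hk h (by omega)
        · exact h5 k h hkb
      obtain ⟨h7, h8, h9⟩ := hL.step hI hj hjn hr h1 h3 h2 h4 hs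
        (Function.update s.pushed j (s.pushed j ++ [(b, q - b)])) (s.betaTime + t)
      obtain ⟨q', s', h10, h11, h12, h13, h14⟩ := ih _ _ _ h9 (by omega)
      refine ⟨q', s', h10, h11, h12, ?_, ?_⟩
      · have h15 := potential_update (n := w.length) (b := b) s.len (p := q - b) (by omega)
          (by omega)
        have h16 := add_log_le h6
        rw [h7] at h15
        dsimp only at h13
        omega
      · have h15 := potential_update (n := w.length) (b := b) s.len (p := q - b) (by omega)
          (by omega)
        -- `2 * len j < b` means that the length plus one at least doubles: one unit of potential
        -- per push.
        have h16 := add_log_le (t := 1) (l := s₀.len j) (b := b) (by omega)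
        rw [h7] at h15
        rw [totalStackSize_push w hj hjn] at h14
        dsimp only at h14
        omega

theorem Inv.lufValue_isLuf (hI : Inv w (j + 1) s₀) (hj : 1 ≤ j) (hjn : j ≤ w.length) :
    IsLuf (letter w) (w.length + 1) j (lufValue w s₀ j) := by
  unfold lufValue
  split_ifs with h0
  · have := isLuf_of_forall_not_agree (f := letter w) (N := w.length + 1) (i := j) (by omega)
      fun x L h1 h2 h3 => not_agree_of_lsfLength_eq_zero hj h0 h1 h2 h3
    rwa [show w.length + 1 - j = w.length - j + 1 by omega] at this
  have hl := lsf_spec hj h0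
  have h1 := hl.lt
  have h2 := hl.le
  have h3 := hl.pos
  have hluf := hI.luf (lsfRef w j) h1 (by omega)
  dsimp only
  split_ifs with h4 h5
  · exact hl.isLuf_of_lt hluf h4
  · exact hl.isLuf_of_hook_le hluf (by omega)
      (hI.hook_ref _ h1 (by omega) ⟨j, _, _, hj, hl, hluf, by omega⟩) h5
  · exact hl.isLuf_of_lt_hook hj hluf (by omega)
      (hI.hook_ref _ h1 (by omega) ⟨j, _, _, hj, hl, hluf, by omega⟩) (by omega)

/-- One round of the main loop. -/
theorem Inv.process (hI : Inv w (j + 1) s₀) (hj : 1 ≤ j) (hjn : j ≤ w.length) :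
    ∃ s, processPosition w j s₀ = some s ∧ Inv w j s ∧
      s.betaTime + potential w.length s₀.len ≤ s₀.betaTime + potential w.length s.len +
        (if j = 1 then 0 else Nat.log 2 (w.length + 1) + 1) ∧
      totalStackSize w s + potential w.length s₀.len ≤
        totalStackSize w s₀ + potential w.length s.len := by
  have hluf := hI.lufValue_isLuf hj hjn
  have hI₁ := hI.update_luf (lufValue w s₀ j)
  unfold processPosition
  have hj₁ : IsLuf (letter w) (w.length + 1) j
      (Function.update s₀.luf j (lufValue w s₀ j) j) := by rwa [Function.update_self]
  have hall : ∀ i, j ≤ i → i < w.length + 1 → IsLuf (letter w) (w.length + 1) i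
      (Function.update s₀.luf j (lufValue w s₀ j) i) := by
    intro i hi hiN
    rcases hi.eq_or_lt with rfl | hi
    · exact hj₁
    · exact hI₁.luf i hi hiN
  dsimp only
  have hiff := isPotentialReference_iff (luf := Function.update s₀.luf j (lufValue w s₀ j)) hj hj₁
  split_ifs with hr h1 h1
  -- Nothing precedes position 1, so it is never a reference and causes no failing search.
  · obtain ⟨i, L, l, hi, hlsf, -⟩ := hiff.1 hr
    have := hlsf.lt
    omega
  · obtain ⟨q, s, h2, h3, h4, h5, h6⟩ := findHookLoop_spec hI₁ hj hjn (hiff.1 hr) (w.length + 1) _ _ _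
      (hI₁.loopInv_start hj hjn) (by
        have := (hI₁.hook j hj (by omega)).tiles.le
        omega)
    have h7 : findHook w j { s₀ with luf := Function.update s₀.luf j (lufValue w s₀ j) } =
      some (q, s) := h2
    rw [h7]
    refine ⟨_, rfl, ⟨fun p hp hpj hl => ?_, fun p hp hpj k l hk hjk hl => ?_, fun p hp hpj => ?_,
      fun i hi hiN => ?_, fun i hi hiN hir => ?_, h3.len_lt⟩, h5, h6⟩
    · rcases lt_or_ge p q with h8 | h8
      · have h9 := (h3.low p (Or.inl h8)).1
        change 0 < s.len p at hl
        change ∃ k, _ ∧ _ ∧ Piece _ _ p (s.len p) k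
        rw [h9] at hl ⊢
        obtain ⟨k, hk, hjk, hpk⟩ := hI₁.sound p hp (by omega) hl
        exact ⟨k, hk, by omega, hpk⟩
      · exact h3.sound p h8 hpj hl
    · rcases lt_or_ge p q with h8 | h8
      · rcases hjk.eq_or_lt with rfl | hjk
        -- A tiling from the left of the final `q` up to `j`, cut at `q`, would contradict the
        -- failed search.
        · obtain ⟨c, c1, c2, c3, c4, -⟩ := hl.tiles_self.exists_suffix h8 h3.tiles.le
          refine (h4 (q - c) (by omega) (by omega) (by omega) ?_).elim
          rwa [show q - (q - c) = c by omega]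
        · have h9 := (h3.low p (Or.inl h8)).1
          change l ≤ s.len p
          rw [h9]
          exact hI₁.complete p hp (by omega) k l hk hjk hl
      · exact h3.complete p h8 hpj k l hk hjk hl
    · change IsHook _ p (s.len p) (Function.update s.hook j q p)
      rw [Function.update_of_ne (by omega)]
      rcases lt_or_ge p q with h8 | h8
      · rw [(h3.low p (Or.inl h8)).1, (h3.low p (Or.inl h8)).2]
        exact hI₁.hook p hp (by omega)
      · exact (h3.hook p h8 hpj).resolve_left (by simp)
    · change IsLuf _ _ i (s.luf i)
      rw [h3.luf]
      exact hall i hi hiN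
    · change IsHook _ i _ (Function.update s.hook j q i)
      rcases hi.eq_or_lt with rfl | hi
      · rw [Function.update_self]
        exact ⟨h3.pos, h3.tiles, fun k hk hkN hkq => h4 k hk (by omega) hkq⟩
      · rw [Function.update_of_ne (by omega), (h3.low i (Or.inr (by omega))).2]
        exact hI₁.hook_ref i hi hiN hir
  all_goals
    have hne : ∀ k, IsReference (letter w) (w.length + 1) k → j ≤ k → j + 1 ≤ k := by
      intro k hk hjk
      rcases hjk.eq_or_lt with rfl | hjk
      · exact absurd (hiff.2 hk) hr
      · exact hjk
    refine ⟨_, rfl, ⟨fun p hp hpj hl => ?_, fun p hp hpj k l hk hjk hl => ?_,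
      fun p hp hpj => hI.hook p hp (by omega), hall,
      fun i hi hiN hir => hI.hook_ref i (hne i hir hi) hiN hir, hI.len_lt⟩,
      Nat.le_add_right _ _, le_rfl⟩
    · obtain ⟨k, hk, hjk, hpk⟩ := hI.sound p hp (by omega) hl
      exact ⟨k, hk, by omega, hpk⟩
    · exact hI.complete p hp (by omega) k l hk (hne k hk hjk) hl

/-- The factor `i - 1` rather than `i` matters: for a word of length 1 the claimed bound is zero. -/
theorem mainLoop_spec : ∀ i s, i ≤ w.length → Inv w (i + 1) s →
    ∃ s', mainLoop w i s = some s' ∧ Inv w 1 s' ∧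
      s'.betaTime + potential w.length s.len ≤ s.betaTime + potential w.length s'.len +
        (i - 1) * (Nat.log 2 (w.length + 1) + 1) ∧
      totalStackSize w s' + potential w.length s.len ≤
        totalStackSize w s + potential w.length s'.len := by
  intro i
  induction i with
  | zero => exact fun s _ hs => ⟨s, rfl, hs, by simp, le_rfl⟩
  | succ i ih =>
    intro s hi hs
    obtain ⟨s₁, h1, h2, h3, h4⟩ := hs.process (by omega) hi
    obtain ⟨s', h5, h6, h7, h8⟩ := ih s₁ (by omega) h2
    refine ⟨s', by rw [mainLoop, h1, Option.bind_some, h5], h6, ?_, by omega⟩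
    rcases i with _ | i
    · simp only [zero_add, if_true] at h3
      simp only [zero_add, Nat.sub_self, Nat.zero_sub, zero_mul] at h7 ⊢
      omega
    · rw [if_neg (by omega)] at h3
      simp only [Nat.add_sub_cancel] at h7 ⊢
      rw [add_mul, one_mul]
      omega

theorem run_spec (w : List α) : ∃ s, run w = some s ∧
    totalStackSize w s ≤ w.length * Nat.log 2 w.length ∧
    s.betaTime ≤ 4 * (w.length * Nat.log 2 w.length) := by
  obtain ⟨s, h1, h2, h3, h4⟩ := mainLoop_spec w.length initialState le_rfl (inv_initialState w)
  have h5 := potential_le h2.len_lt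
  have h6 : totalStackSize w initialState = 0 := by simp [totalStackSize, initialState]
  have h7 : initialState.betaTime = 0 := rfl
  refine ⟨s, h1, by omega, ?_⟩
  -- For `n ≥ 2`, `log₂ (n + 1) + 1 ≤ log₂ n + 2 ≤ 3 log₂ n`, with rounded logarithms; the potential
  -- adds the fourth `n log₂ n`.
  have h8 : (w.length - 1) * (Nat.log 2 (w.length + 1) + 1) ≤
      3 * (w.length * Nat.log 2 w.length) := by
    rcases lt_or_ge w.length 2 with h9 | h9
    · rw [show w.length - 1 = 0 by omega, zero_mul]
      exact Nat.zero_le _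
    · have h10 : Nat.log 2 (w.length + 1) ≤ Nat.log 2 w.length + 1 := by
        rw [← Nat.log_mul_base (by omega) (by omega)]
        exact Nat.log_mono_right (by omega)
      have h11 : 1 ≤ Nat.log 2 w.length := Nat.log_pos (by omega) h9
      calc (w.length - 1) * (Nat.log 2 (w.length + 1) + 1)
          ≤ w.length * (3 * Nat.log 2 w.length) := Nat.mul_le_mul (by omega) (by omega)
        _ = _ := by ring
  omega

end Counting

end LUFArray

theorem mainTheorem4 :
    ∃ C : ℝ, ∀ (α : Type*) [DecidableEq α] (w : List α),
      ∃ s : LUFArray.State, LUFArray.run w = some s ∧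
        (LUFArray.totalStackSize w s : ℝ) ≤ C * (w.length * Real.log w.length) ∧
        (s.betaTime : ℝ) ≤ C * (w.length * Real.log w.length) := by
  -- The division by `Real.log 2` converts base 2 to the natural logarithm.
  refine ⟨4 / Real.log 2, fun α _ w => ?_⟩
  obtain ⟨s, h1, h2, h3⟩ := LUFArray.run_spec w
  have h4 : ((4 * (w.length * Nat.log 2 w.length) : ℕ) : ℝ) ≤
      4 / Real.log 2 * (w.length * Real.log w.length) := by
    have h5 := Real.natLog_le_logb w.length 2
    rw [Real.logb, Nat.cast_ofNat] at h5
    calc ((4 * (w.length * Nat.log 2 w.length) : ℕ) : ℝ)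
        = 4 * (w.length * (Nat.log 2 w.length : ℝ)) := by push_cast; ring
      _ ≤ 4 * (w.length * (Real.log w.length / Real.log 2)) := by gcongr
      _ = _ := by ring
  refine ⟨s, h1, le_trans ?_ h4, le_trans ?_ h4⟩
  · exact_mod_cast h2.trans (by omega)
  · exact_mod_cast h3
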